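/- Let $0<\varepsilon_0<1$. For $0<j\le 1$, $\tau\in(0,\infty]$ (with $1/\tau:=0$ if $\tau=\infty$), $B\in L^\infty(\varepsilon_0,1)$ and $\eta_0\in\mathbb R$ consider on $(\varepsilon_0,1)$ the system $$\Big[r^2\Big(\tfrac1g-\tfrac{j^2}{g^3}\Big)g_r+\tfrac{j}{\tau}\tfrac{r^2}{g}-2r\Big]_r=g-m-B,\qquad \Big[r^2\Big(\tfrac1m-\tfrac{j^2}{m^3}\Big)m_r-\tfrac{j}{\tau}\tfrac{r^2}{m}-2r\Big]_r=m+B-g,$$ $$g(\varepsilon_0)=g(1)=1,\qquad m(\varepsilon_0)=\eta_0. \qquad (1)$$ A subsonic solution of (1) is a pair of continuous functions $(g,m)$ on $[\varepsilon_0,1]$ with these boundary values, $g>1$ on $(\varepsilon_0,1)$, $m>1$ on $[\varepsilon_0,1]$, $(g-1)^2\in H^1_0(\varepsilon_0,1)$, $\big(\tfrac1g-\tfrac{j^2}{g^3}\big)g_r\in L^2(\varepsilon_0,1)$ (automatic if $j=1$), $m\in W^{2,\infty}(\varepsilon_0,1)$, such that both equations hold weakly against every test function in $H_0^1(\varepsilon_0,1)$.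 It is called compatible if $$F_j(m(1))-F_j(\eta_0)+\frac j\tau\int_{\varepsilon_0}^1\Big(\frac1g-\frac1m\Big)dr+4\ln\varepsilon_0=0,\qquad F_j(h):=\ln h+\frac{j^2}{2h^2}.$$ For $b\in L^\infty(\varepsilon_0,1)$ consider also the radial bipolar hydrodynamic system $$\tfrac12\rho\Big(\tfrac{J^2}{\rho^2}\Big)_r+\rho_r=\rho E-\tfrac J\tau,\quad \tfrac12 n\Big(\tfrac{K^2}{n^2}\Big)_r+n_r=-nE-\tfrac K\tau,\quad (r^2E)_r=r^2(\rho-n-b),\quad J=\tfrac{j}{r^2},\ K=-\tfrac{j}{r^2}. \qquad (2)$$ A subsonic solution of (2) is a triple of continuous functions $(\rho,n,E)$ on $[\varepsilon_0,1]$ that satisfies (2) a.e. with weak derivatives, such that, for $g=r^2\rho$ and $m=r^2n$, one has $g(\varepsilon_0)=g(1)=1$, $m(\varepsilon_0)=\eta_0$, $g>1$ on $(\varepsilon_0,1)$, $m>1$ on $[\varepsilon_0,1]$, $(g-1)^2\in H_0^1(\varepsilon_0,1)$ and $n\in W^{2,\infty}(\varepsilon_0,1)$. Theorem. (i) Let $\tau=\infty$.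 For all $j\in(0,1]$ and $\eta_0$, and all $B$ (resp. $b$) in $L^\infty(\varepsilon_0,1)$, any two compatible subsonic solutions $(g,m)$ of (1) coincide on $[\varepsilon_0,1]$, and any two subsonic solutions $(\rho,n,E)$ of (2) coincide on $[\varepsilon_0,1]$. (ii) For every $\underline m>1$ and $\eta_0$ there is $\delta>0$, depending only on $\varepsilon_0,\underline m,\eta_0$, such that for all $j\in(0,1]$ and $\tau\in(0,\infty]$ with $j/\tau\le\delta$ and all $B$ (resp. $b$) in $L^\infty(\varepsilon_0,1)$: a compatible subsonic solution $(g,m)$ of (1) with $m\ge\underline m+3$ on $[\varepsilon_0,1]$ coincides on $[\varepsilon_0,1]$ with every compatible subsonic solution of (1), and a subsonic solution $(\rho,n,E)$ of (2) with $r^2n\ge\underline m+3$ on $[\varepsilon_0,1]$ coincides on $[\varepsilon_0,1]$ with every subsonic solution of (2). -/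

import Mathlib

open Set MeasureTheory
open scoped ENNReal ContDiff

/-- `f'` is the weak derivative of `f` on the open interval `(a, b)`. -/
def IsWeakDeriv (a b : ℝ) (f f' : ℝ → ℝ) : Prop :=
  LocallyIntegrableOn f (Ioo a b) ∧ LocallyIntegrableOn f' (Ioo a b) ∧
    ∀ φ : ℝ → ℝ, ContDiff ℝ ∞ φ → HasCompactSupport φ → tsupport φ ⊆ Ioo a b →
      ∫ x in Ioo a b, f x * deriv φ x = -∫ x in Ioo a b, f' x * φ x

/-- `f` is (the continuous representative of) an element of the Sobolev space `H¹₀(a, b)`,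
and `f'` is its weak derivative. -/
structure IsH10 (a b : ℝ) (f f' : ℝ → ℝ) : Prop where
  continuousOn : ContinuousOn f (Icc a b)
  weakDeriv : IsWeakDeriv a b f f'
  memLp : MemLp f' 2 (volume.restrict (Ioo a b))
  left_zero : f a = 0
  right_zero : f b = 0

/-- `f` is (the continuous representative of) an element of the Sobolev space `W^{2,∞}(a, b)`. -/
def MemW2Infty (a b : ℝ) (f : ℝ → ℝ) : Prop :=
  ContinuousOn f (Icc a b) ∧ MemLp f ∞ (volume.restrict (Ioo a b)) ∧
    ∃ f₁ f₂ : ℝ → ℝ, IsWeakDeriv a b f f₁ ∧ IsWeakDeriv a b f₁ f₂ ∧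
      MemLp f₁ ∞ (volume.restrict (Ioo a b)) ∧ MemLp f₂ ∞ (volume.restrict (Ioo a b))

/-- The rate `1/τ` of the relaxation time `τ ∈ (0, ∞]`; it is `0` for `τ = ∞`. -/
noncomputable def relaxRate (τ : ℝ≥0∞) : ℝ := (τ⁻¹).toReal

/-- The function `ln h + j² / (2 h²)`. -/
noncomputable def enthalpy (j h : ℝ) : ℝ := Real.log h + j ^ 2 / (2 * h ^ 2)

/-- `(g, m)` is a pair of subsonic weak solutions on `(ε₀, 1)` of
`[r² (1/g - j²/g³) g_r + (j/τ) r²/g - 2 r]_r = g - m - B`,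
`[r² (1/m - j²/m³) m_r - (j/τ) r²/m - 2 r]_r = m + B - g`,
`g(ε₀) = g(1) = 1`, `m(ε₀) = η₀`, where `g` is interiorly subsonic and `m` fully subsonic.

The square integrability of the flux in `weak_g` makes the weak formulation meaningful. For `j = 1`
it follows from `sq_memH10`, because `(1/g - 1/g³) g_r = (g + 1) ((g - 1)²)_r / (2 g³)`. -/
structure IsSubsonicPair (ε₀ j : ℝ) (τ : ℝ≥0∞) (B : ℝ → ℝ) (η₀ : ℝ) (g m : ℝ → ℝ) : Prop where
  continuousOn_g : ContinuousOn g (Icc ε₀ 1)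
  subsonic_g : ∀ r ∈ Ioo ε₀ 1, 1 < g r
  subsonic_m : ∀ r ∈ Icc ε₀ 1, 1 < m r
  g_left : g ε₀ = 1
  g_right : g 1 = 1
  m_left : m ε₀ = η₀
  sq_memH10 : ∃ s : ℝ → ℝ, IsH10 ε₀ 1 (fun r => (g r - 1) ^ 2) s
  m_memW2Infty : MemW2Infty ε₀ 1 m
  weak_g : ∃ gr : ℝ → ℝ, IsWeakDeriv ε₀ 1 g gr ∧
    MemLp (fun r => (1 / g r - j ^ 2 / g r ^ 3) * gr r) 2 (volume.restrict (Ioo ε₀ 1)) ∧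
    ∀ φ φr : ℝ → ℝ, IsH10 ε₀ 1 φ φr →
      (∫ r in Ioo ε₀ 1, (r ^ 2 * (1 / g r - j ^ 2 / g r ^ 3) * gr r
          + j * relaxRate τ * (r ^ 2 / g r) - 2 * r) * φr r)
        + ∫ r in Ioo ε₀ 1, (g r - m r - B r) * φ r = 0
  weak_m : ∃ mr : ℝ → ℝ, IsWeakDeriv ε₀ 1 m mr ∧
    ∀ φ φr : ℝ → ℝ, IsH10 ε₀ 1 φ φr →
      (∫ r in Ioo ε₀ 1, (r ^ 2 * (1 / m r - j ^ 2 / m r ^ 3) * mr r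
          - j * relaxRate τ * (r ^ 2 / m r) - 2 * r) * φr r)
        + ∫ r in Ioo ε₀ 1, (m r + B r - g r) * φ r = 0

/-- The value `m(1)` satisfies the compatibility condition under which the second order system for
`(g, m)` is equivalent to the first order system
`(1/g - j²/g³) g_r + (j/τ)/g - 2/r = E`, `(1/m - j²/m³) m_r - (j/τ)/m - 2/r = -E`,
`(r² E)_r = g - m - B`. -/
def IsCompatible (ε₀ j : ℝ) (τ : ℝ≥0∞) (η₀ : ℝ) (g m : ℝ → ℝ) : Prop :=
  enthalpy j (m 1) - enthalpy j η₀
    + j * relaxRate τ * (∫ r in Ioo ε₀ 1, (1 / g r - 1 / m r)) + 4 * Real.log ε₀ = 0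

/-- The current density of electrons in the radial system, `J = j / r²`. -/
noncomputable def electronCurrent (j r : ℝ) : ℝ := j / r ^ 2

/-- The current density of holes in the radial system, `K = -j / r²`. -/
noncomputable def holeCurrent (j r : ℝ) : ℝ := -j / r ^ 2

/-- `(ρ, n, E)` is a subsonic solution on `(ε₀, 1)` of the radial isothermal steady system
`½ ρ (J²/ρ²)_r + ρ_r = ρ E - J/τ`, `½ n (K²/n²)_r + n_r = -n E - K/τ`,
`(r² E)_r = r² (ρ - n - b)`, with `J = j/r²` and `K = -j/r²`, with `r² ρ = 1` at `r = ε₀` and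
`r = 1`, and `r² n = η₀` at `r = ε₀`. The derivatives are weak derivatives. -/
structure IsSubsonicRadialSolution (ε₀ j : ℝ) (τ : ℝ≥0∞) (b : ℝ → ℝ) (η₀ : ℝ)
    (ρ n E : ℝ → ℝ) : Prop where
  continuousOn_ρ : ContinuousOn ρ (Icc ε₀ 1)
  continuousOn_E : ContinuousOn E (Icc ε₀ 1)
  subsonic_ρ : ∀ r ∈ Ioo ε₀ 1, 1 < r ^ 2 * ρ r
  subsonic_n : ∀ r ∈ Icc ε₀ 1, 1 < r ^ 2 * n r
  ρ_left : ε₀ ^ 2 * ρ ε₀ = 1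
  ρ_right : 1 ^ 2 * ρ 1 = 1
  n_left : ε₀ ^ 2 * n ε₀ = η₀
  sq_memH10 : ∃ s : ℝ → ℝ, IsH10 ε₀ 1 (fun r => (r ^ 2 * ρ r - 1) ^ 2) s
  n_memW2Infty : MemW2Infty ε₀ 1 n
  momentum_ρ : ∃ ρr q : ℝ → ℝ, IsWeakDeriv ε₀ 1 ρ ρr ∧
    IsWeakDeriv ε₀ 1 (fun r => electronCurrent j r ^ 2 / ρ r ^ 2) q ∧
    ∀ᵐ r ∂(volume.restrict (Ioo ε₀ 1)),
      1 / 2 * ρ r * q r + ρr r = ρ r * E r - electronCurrent j r * relaxRate τ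
  momentum_n : ∃ nr q : ℝ → ℝ, IsWeakDeriv ε₀ 1 n nr ∧
    IsWeakDeriv ε₀ 1 (fun r => holeCurrent j r ^ 2 / n r ^ 2) q ∧
    ∀ᵐ r ∂(volume.restrict (Ioo ε₀ 1)),
      1 / 2 * n r * q r + nr r = -(n r * E r) - holeCurrent j r * relaxRate τ
  poisson : IsWeakDeriv ε₀ 1 (fun r => r ^ 2 * E r) (fun r => r ^ 2 * (ρ r - n r - b r))

/-! Write `F` for the enthalpy, `P = r² E` and `a = j/τ`. Both problems reduce to one first order
system, `IsFirstOrderPair`, and uniqueness is an `L¹` argument for it.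

Let two solutions be given. On a component of `{g₁ > g₂}` the function `F(g₁) - F(g₂)` is positive
inside and vanishes at both ends, so its derivative is `≥ 0` on the left and `≤ 0` on the right. At
the ends this derivative equals `(P₁ - P₂)/r²`, since the terms in `a` cancel there. Hence `P₁ - P₂`
does not increase across the component in total, which says that the integral of `(g₁ - g₂) - (m₁ -
m₂)` is nonpositive (`integral_component_nonpos`, `setIntegral_lt_nonpos`).

The field drops out of the sum of the two equations, so `F(g) + F(m)` is known up to a term of size
`a` (`enthalpy_add`, `abs_enthalpy_add_sub_le`). Thus where `g₁ > g₂`, the difference `m₁ - m₂` is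
nonpositive up to that error, and the integral inequality bounds `‖g₁ - g₂‖₁` by the error alone.
Converting enthalpies of `m` back to values of `m` needs an inverse Lipschitz bound
(`abs_sub_le_mul_abs_enthalpy_sub`). `F` may degenerate at `1`, but it suffices that one of the two
values stays away from `1`; `g` needs no such bound. The result is `d + e ≤ (K² + 2K) a (d + e)` for
the `L¹` distances `d`, `e` of the components (`eqOn_of_abs_sub_le`), which forces `d + e = 0` if `a
= 0` or `a` is small. -/

/-! ### Upper and lower bounds for increments of the enthalpy. -/

theorem enthalpy_sub_ge {j x y : ℝ} (hj₀ : 0 ≤ j) (hj₁ : j ≤ 1) (hy : 1 ≤ y) (hxy : y ≤ x) :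
    (x - y) * ((2 * x * y - x - y) / ((x + y) * x * y)) ≤ enthalpy j x - enthalpy j y := by
  have hy₀ : 0 < y := by linarith
  have hx₀ : 0 < x := by linarith
  have hlog : 2 * (x - y) / (x + y) ≤ Real.log x - Real.log y := by
    have h := Real.le_log_one_add_of_nonneg (x := (x - y) / y) (by
      apply div_nonneg <;> linarith)
    have e₁ : 1 + (x - y) / y = x / y := by field_simp; ring
    have e₂ : 2 * ((x - y) / y) / ((x - y) / y + 2) = 2 * (x - y) / (x + y) := by
      have : (x - y) / y + 2 = (x + y) / y := by field_simp; ring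
      rw [this]; field_simp
    rwa [e₁, e₂, Real.log_div hx₀.ne' hy₀.ne'] at h
  have hj2 : j ^ 2 ≤ 1 := by nlinarith
  have hsq : 1 / x ^ 2 ≤ 1 / y ^ 2 := by gcongr
  have hpot : -(1 / 2) * (1 / y ^ 2 - 1 / x ^ 2) ≤ j ^ 2 / (2 * x ^ 2) - j ^ 2 / (2 * y ^ 2) := by
    have : j ^ 2 / (2 * x ^ 2) - j ^ 2 / (2 * y ^ 2)
        = -(1 / 2) * (j ^ 2 * (1 / y ^ 2 - 1 / x ^ 2)) := by field_simp; ring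
    rw [this]
    nlinarith
  have hpos : 0 ≤ 2 * x * y - x - y := by nlinarith
  -- The right-hand side is the lower bound in the worst case `j = 1`. It factors as `(x - y)(2xy -
  -- x - y)(2xy + x + y) / (2(x + y)x²y²)`; the summand `2xy` of the last factor gives the claimed
  -- bound, the summand `x + y` a nonnegative rest.
  have key : (x - y) * ((2 * x * y - x - y) / ((x + y) * x * y))
      + (x - y) * (2 * x * y - x - y) * (x + y) / (2 * (x + y) * x ^ 2 * y ^ 2)
      = 2 * (x - y) / (x + y) - (1 / 2) * (1 / y ^ 2 - 1 / x ^ 2) := by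
    field_simp; ring
  have : 0 ≤ (x - y) * (2 * x * y - x - y) * (x + y) / (2 * (x + y) * x ^ 2 * y ^ 2) := by
    have : 0 ≤ x - y := by linarith
    positivity
  unfold enthalpy
  linarith

theorem enthalpy_strictMonoOn {j : ℝ} (hj₀ : 0 ≤ j) (hj₁ : j ≤ 1) :
    StrictMonoOn (enthalpy j) (Ici 1) := by
  intro y hy x hx hxy
  have hy : 1 ≤ y := hy
  have h := enthalpy_sub_ge hj₀ hj₁ hy hxy.le
  have : 0 < (x - y) * ((2 * x * y - x - y) / ((x + y) * x * y)) := by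
    have h₁ : 0 < x - y := by linarith
    have h₂ : 0 < 2 * x * y - x - y := by nlinarith
    have : 0 < y := by linarith
    have : 0 < x := by linarith
    positivity
  linarith

theorem enthalpy_sub_le {j x y : ℝ} (hy : 1 ≤ y) (hxy : y ≤ x) :
    enthalpy j x - enthalpy j y ≤ x - y := by
  have hy₀ : 0 < y := by linarith
  have hx₀ : 0 < x := by linarith
  have h₁ : Real.log x - Real.log y ≤ x - y := by
    rw [← Real.log_div hx₀.ne' hy₀.ne']
    have h := Real.log_le_sub_one_of_pos (div_pos hx₀ hy₀)
    have : x / y - 1 = (x - y) / y := by field_simp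
    have : (x - y) / y ≤ x - y := div_le_self (by linarith) hy
    linarith
  have h₂ : j ^ 2 / (2 * x ^ 2) ≤ j ^ 2 / (2 * y ^ 2) := by gcongr
  unfold enthalpy
  linarith

theorem abs_enthalpy_sub_le {j x y : ℝ} (hj₀ : 0 ≤ j) (hj₁ : j ≤ 1) (hx : 1 ≤ x) (hy : 1 ≤ y) :
    |enthalpy j x - enthalpy j y| ≤ |x - y| := by
  have hm := (enthalpy_strictMonoOn hj₀ hj₁).monotoneOn
  rcases le_total y x with h | h
  · rw [abs_of_nonneg (sub_nonneg.2 (hm hy hx h)), abs_of_nonneg (sub_nonneg.2 h)]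
    exact enthalpy_sub_le hy h
  · rw [abs_sub_comm, abs_sub_comm x, abs_of_nonneg (sub_nonneg.2 (hm hx hy h)),
      abs_of_nonneg (sub_nonneg.2 h)]
    exact enthalpy_sub_le hx h

/-- Inverse Lipschitz bound that survives `j = 1`, where `F'(1) = 0`. Since `2xy - x - y = x(y - 1)
+ y(x - 1)`, a constant `c` exists as soon as one of the two points stays away from `1`. -/
theorem abs_sub_le_mul_abs_enthalpy_sub {j x y M c : ℝ} (hj₀ : 0 ≤ j) (hj₁ : j ≤ 1)
    (hx : 1 ≤ x) (hy : 1 ≤ y) (hxM : x ≤ M) (hyM : y ≤ M) (hc : 0 < c)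
    (hxy : c ≤ 2 * x * y - x - y) :
    |x - y| ≤ 2 * M ^ 3 / c * |enthalpy j x - enthalpy j y| := by
  wlog h : y ≤ x generalizing x y
  · rw [abs_sub_comm, abs_sub_comm (enthalpy j x)]
    exact this hy hx hyM hxM (by linarith) (by linarith)
  have hM : 1 ≤ M := by linarith
  have hm := (enthalpy_strictMonoOn hj₀ hj₁).monotoneOn
  rw [abs_of_nonneg (sub_nonneg.2 (hm hy hx h)), abs_of_nonneg (sub_nonneg.2 h)]
  have h₁ := enthalpy_sub_ge hj₀ hj₁ hy h
  have h₂ : (x + y) * x * y ≤ (M + M) * M * M := by gcongr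
  have h₃ : c / (2 * M ^ 3) ≤ (2 * x * y - x - y) / ((x + y) * x * y) := by
    have : 0 < (x + y) * x * y := by positivity
    apply div_le_div₀ (by linarith) hxy this
    linarith
  have h₄ : (x - y) * (c / (2 * M ^ 3)) ≤ enthalpy j x - enthalpy j y :=
    le_trans (mul_le_mul_of_nonneg_left h₃ (by linarith)) h₁
  have hM3 : 0 < 2 * M ^ 3 / c := by positivity
  calc x - y = 2 * M ^ 3 / c * ((x - y) * (c / (2 * M ^ 3))) := by field_simp
    _ ≤ _ := by gcongr

theorem hasDerivAt_enthalpy {j h : ℝ} (hh : 0 < h) :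
    HasDerivAt (enthalpy j) (1 / h - j ^ 2 / h ^ 3) h := by
  have h₁ := Real.hasDerivAt_log hh.ne'
  have h₂ : HasDerivAt (fun h : ℝ => 2 * h ^ 2) (2 * (2 * h)) h := by
    simpa using (hasDerivAt_pow 2 h).const_mul 2
  have h₃ := (hasDerivAt_const h (j ^ 2)).div h₂ (by positivity)
  convert! h₁.add h₃ using 1
  field_simp
  ring

theorem continuousOn_enthalpy (j : ℝ) : ContinuousOn (enthalpy j) (Ioi 0) := fun _ hx =>
  (hasDerivAt_enthalpy hx).continuousAt.continuousWithinAt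

/-! ### Components of open sets and signs of derivatives at their ends. -/

/-- An integral over an open set is nonpositive if the integrals over all its components are. -/
theorem setIntegral_nonpos_of_components {A : Set ℝ} {f : ℝ → ℝ} {l u : ℝ} (hA : IsOpen A)
    (hlu : A ⊆ Ioo l u) (hf : IntegrableOn f A)
    (h : ∀ α β, α < β → Ioo α β ⊆ A → α ∉ A → β ∉ A → ∫ x in Ioo α β, f x ≤ 0) :
    ∫ x in A, f x ≤ 0 := by
  let S : Set (ℝ × ℝ) := {p | p.1 < p.2 ∧ Ioo p.1 p.2 ⊆ A ∧ p.1 ∉ A ∧ p.2 ∉ A}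
  have hdisj : S.PairwiseDisjoint fun p => Ioo p.1 p.2 := by
    rintro ⟨a₁, b₁⟩ ⟨-, hs₁, ha₁, hb₁⟩ ⟨a₂, b₂⟩ ⟨-, hs₂, ha₂, hb₂⟩ hne
    refine Set.disjoint_left.2 fun z hz₁ hz₂ => hne ?_
    simp only [mem_Ioo] at hz₁ hz₂ ha₁ hb₁ ha₂ hb₂ hs₁ hs₂
    -- If the left ends differed, the larger one would lie inside the other interval and hence in
    -- `A`.
    have e₁ : a₁ = a₂ := by
      rcases lt_trichotomy a₁ a₂ with h | h | h
      · exact (ha₂ (hs₁ ⟨h, by linarith⟩)).elim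
      · exact h
      · exact (ha₁ (hs₂ ⟨h, by linarith⟩)).elim
    have e₂ : b₁ = b₂ := by
      rcases lt_trichotomy b₁ b₂ with h | h | h
      · exact (hb₁ (hs₂ ⟨by linarith, h⟩)).elim
      · exact h
      · exact (hb₂ (hs₁ ⟨by linarith, h⟩)).elim
    rw [e₁, e₂]
  have hcount : S.Countable := hdisj.countable_of_isOpen (fun _ _ => isOpen_Ioo)
    fun p hp => nonempty_Ioo.2 hp.1
  have hunion : A = ⋃ p : S, Ioo p.1.1 p.1.2 := by
    apply Subset.antisymm
    · intro x hx
      have hl : l ∉ A := fun hl => lt_irrefl l (hlu hl).1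
      have hu : u ∉ A := fun hu => lt_irrefl u (hlu hu).2
      have hc : IsClosed Aᶜ := hA.isClosed_compl
      have hbdd : BddAbove (Aᶜ ∩ Iic x) := ⟨x, fun _ hy => hy.2⟩
      have hbdd' : BddBelow (Aᶜ ∩ Ici x) := ⟨x, fun _ hy => hy.2⟩
      -- The component of `x` runs from the last point of the complement before `x` to the first one
      -- after it; closedness puts both ends in the complement.
      have m₁ := (hc.inter isClosed_Iic).csSup_mem ⟨l, hl, (hlu hx).1.le⟩ hbdd
      have m₂ := (hc.inter isClosed_Ici).csInf_mem ⟨u, hu, (hlu hx).2.le⟩ hbdd'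
      have n₁ : sSup (Aᶜ ∩ Iic x) < x := lt_of_le_of_ne m₁.2 fun e => m₁.1 (by rwa [e])
      have n₂ : x < sInf (Aᶜ ∩ Ici x) := lt_of_le_of_ne m₂.2 fun e => m₂.1 (by rwa [← e])
      refine mem_iUnion.2 ⟨⟨(sSup (Aᶜ ∩ Iic x), sInf (Aᶜ ∩ Ici x)), n₁.trans n₂, ?_,
        m₁.1, m₂.1⟩, n₁, n₂⟩
      intro z hz
      by_contra hzA
      rcases le_total z x with hzx | hzx
      · exact absurd (le_csSup hbdd ⟨hzA, hzx⟩) (not_le.2 hz.1)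
      · exact absurd (csInf_le hbdd' ⟨hzA, hzx⟩) (not_le.2 hz.2)
    · exact iUnion_subset fun p => p.2.2.1
  have : Countable S := hcount.to_subtype
  rw [hunion] at hf ⊢
  rw [integral_iUnion (fun _ : S => measurableSet_Ioo) (fun p q hpq => hdisj p.2 q.2
    fun e => hpq (Subtype.ext e)) hf]
  exact tsum_nonpos fun p => h _ _ p.2.1 p.2.2.1 p.2.2.2.1 p.2.2.2.2

/-- `U` is not assumed differentiable at `α`, which may be `ε₀`. If `φ α < 0`, then `φ < 0` just to
the right of `α`, and the mean value theorem contradicts `U > 0 = U α`. -/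
theorem deriv_nonneg_of_pos_right {U φ : ℝ → ℝ} {α β : ℝ} (hαβ : α < β)
    (hU : ContinuousOn U (Icc α β)) (hφ : ContinuousOn φ (Icc α β))
    (hd : ∀ r ∈ Ioo α β, HasDerivAt U (φ r) r) (hα : U α = 0) (hpos : ∀ r ∈ Ioo α β, 0 < U r) :
    0 ≤ φ α := by
  by_contra! hneg
  have hev : ∀ᶠ r in nhdsWithin α (Icc α β), φ r < 0 :=
    (hφ α (left_mem_Icc.2 hαβ.le)).eventually (gt_mem_nhds hneg)
  rw [nhdsWithin_Icc_eq_nhdsGE hαβ] at hev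
  obtain ⟨c, hc, hsub⟩ := (mem_nhdsGE_iff_exists_Ico_subset' hαβ).1 hev
  have hlt : α < min c ((α + β) / 2) := lt_min hc (by linarith)
  set d := min c ((α + β) / 2)
  have hdβ : d < β := (min_le_right _ _).trans_lt (by linarith)
  obtain ⟨ξ, hξ, he⟩ := exists_hasDerivAt_eq_slope U φ hlt
    (hU.mono (Icc_subset_Icc_right hdβ.le)) fun r hr => hd r ⟨hr.1, hr.2.trans hdβ⟩
  have h₁ : φ ξ < 0 := hsub ⟨hξ.1.le, hξ.2.trans_le (min_le_left _ _)⟩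
  have h₂ : 0 < (U d - U α) / (d - α) := by
    have := hpos d ⟨hlt, hdβ⟩
    have : 0 < d - α := by linarith
    rw [hα]
    positivity
  linarith

theorem deriv_nonpos_of_pos_left {U φ : ℝ → ℝ} {α β : ℝ} (hαβ : α < β)
    (hU : ContinuousOn U (Icc α β)) (hφ : ContinuousOn φ (Icc α β))
    (hd : ∀ r ∈ Ioo α β, HasDerivAt U (φ r) r) (hβ : U β = 0) (hpos : ∀ r ∈ Ioo α β, 0 < U r) :
    φ β ≤ 0 := by
  have hmaps : MapsTo (fun r : ℝ => -r) (Icc (-β) (-α)) (Icc α β) := fun r hr =>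
    ⟨by linarith [hr.2], by linarith [hr.1]⟩
  have h := deriv_nonneg_of_pos_right (U := fun r => U (-r)) (φ := fun r => -φ (-r))
    (neg_lt_neg hαβ) (hU.comp continuous_neg.continuousOn hmaps)
    (hφ.comp continuous_neg.continuousOn hmaps).neg (fun r hr => ?_) (by simpa using hβ)
    (fun r hr => hpos _ ⟨by linarith [hr.2], by linarith [hr.1]⟩)
  · simpa using h
  · have h₁ := hd (-r) ⟨by linarith [hr.2], by linarith [hr.1]⟩
    simpa [Function.comp_def] using h₁.comp r (hasDerivAt_neg r)

/-! ### The first order system and the `L¹` estimate for the difference of two solutions. -/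

/-- `(g, m, P)`, with `P = r² E`, solves the first order system
`F(g)' = (P + 2 r) / r² - a / g`, `F(m)' = (-P + 2 r) / r² + a / m`, `P' = g - m - B`, where
`F` is the enthalpy. -/
structure IsFirstOrderPair (ε₀ j a : ℝ) (B : ℝ → ℝ) (η₀ : ℝ) (g m P : ℝ → ℝ) : Prop where
  continuousOn_g : ContinuousOn g (Icc ε₀ 1)
  continuousOn_m : ContinuousOn m (Icc ε₀ 1)
  continuousOn_P : ContinuousOn P (Icc ε₀ 1)
  one_le_g : ∀ r ∈ Icc ε₀ 1, 1 ≤ g r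
  one_lt_m : ∀ r ∈ Icc ε₀ 1, 1 < m r
  g_left : g ε₀ = 1
  g_right : g 1 = 1
  m_left : m ε₀ = η₀
  hasDerivAt_g : ∀ r ∈ Ioo ε₀ 1,
    HasDerivAt (fun r => enthalpy j (g r)) ((P r + 2 * r) / r ^ 2 - a / g r) r
  hasDerivAt_m : ∀ r ∈ Ioo ε₀ 1,
    HasDerivAt (fun r => enthalpy j (m r)) ((-P r + 2 * r) / r ^ 2 + a / m r) r
  integrableOn_B : IntegrableOn B (Ioo ε₀ 1)
  P_eq : ∀ r ∈ Icc ε₀ 1, P r = P ε₀ + ∫ s in ε₀..r, (g s - m s - B s)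

theorem ContinuousOn.enthalpy_comp {j : ℝ} {f : ℝ → ℝ} {s : Set ℝ} (hf : ContinuousOn f s)
    (h : ∀ r ∈ s, 1 ≤ f r) : ContinuousOn (fun r => enthalpy j (f r)) s :=
  (continuousOn_enthalpy j).comp hf fun r hr => lt_of_lt_of_le one_pos (h r hr)

theorem ContinuousOn.one_div_of_one_le {f : ℝ → ℝ} {s : Set ℝ} (hf : ContinuousOn f s)
    (h : ∀ r ∈ s, 1 ≤ f r) : ContinuousOn (fun r => 1 / f r) s :=
  continuousOn_const.div hf fun r hr => by linarith [h r hr]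

theorem ContinuousOn.intervalIntegrable_of_Icc_subset {f : ℝ → ℝ} {a b x y : ℝ}
    (hf : ContinuousOn f (Icc a b)) (hx : x ∈ Icc a b) (hy : y ∈ Icc a b) :
    IntervalIntegrable f volume x y :=
  (hf.mono (ordConnected_Icc.uIcc_subset hx hy)).intervalIntegrable

theorem MeasureTheory.IntegrableOn.intervalIntegrable_of_mem_Icc {f : ℝ → ℝ} {a b x y : ℝ}
    (hf : IntegrableOn f (Ioo a b)) (hx : x ∈ Icc a b) (hy : y ∈ Icc a b) :
    IntervalIntegrable f volume x y := by
  have h : IntegrableOn f (Icc a b) := by rwa [integrableOn_Icc_iff_integrableOn_Ioo]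
  exact (h.mono_set (ordConnected_Icc.uIcc_subset hx hy)).intervalIntegrable

namespace IsFirstOrderPair

variable {ε₀ j a η₀ : ℝ} {B g m P g₁ m₁ P₁ g₂ m₂ P₂ : ℝ → ℝ}

theorem continuousOn_diff (h₁ : IsFirstOrderPair ε₀ j a B η₀ g₁ m₁ P₁)
    (h₂ : IsFirstOrderPair ε₀ j a B η₀ g₂ m₂ P₂) :
    ContinuousOn (fun r => g₁ r - g₂ r - (m₁ r - m₂ r)) (Icc ε₀ 1) :=
  (h₁.continuousOn_g.sub h₂.continuousOn_g).sub (h₁.continuousOn_m.sub h₂.continuousOn_m)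

theorem P_sub (h₁ : IsFirstOrderPair ε₀ j a B η₀ g₁ m₁ P₁)
    (h₂ : IsFirstOrderPair ε₀ j a B η₀ g₂ m₂ P₂) {x y : ℝ} (hx : x ∈ Icc ε₀ 1)
    (hy : y ∈ Icc ε₀ 1) :
    P₁ y - P₂ y - (P₁ x - P₂ x) = ∫ s in x..y, (g₁ s - g₂ s - (m₁ s - m₂ s)) := by
  have hl : ε₀ ∈ Icc ε₀ 1 := left_mem_Icc.2 (hx.1.trans hx.2)
  have hB := fun {x y : ℝ} (hx : x ∈ Icc ε₀ 1) (hy : y ∈ Icc ε₀ 1) =>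
    h₁.integrableOn_B.intervalIntegrable_of_mem_Icc hx hy
  have i₁ := fun {x y : ℝ} (hx : x ∈ Icc ε₀ 1) (hy : y ∈ Icc ε₀ 1) =>
    ((h₁.continuousOn_g.fun_sub h₁.continuousOn_m).intervalIntegrable_of_Icc_subset hx hy).sub
      (hB hx hy)
  have i₂ := fun {x y : ℝ} (hx : x ∈ Icc ε₀ 1) (hy : y ∈ Icc ε₀ 1) =>
    ((h₂.continuousOn_g.fun_sub h₂.continuousOn_m).intervalIntegrable_of_Icc_subset hx hy).sub
      (hB hx hy)
  have e₁ := intervalIntegral.integral_interval_sub_left (i₁ hl hy) (i₁ hl hx)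
  have e₂ := intervalIntegral.integral_interval_sub_left (i₂ hl hy) (i₂ hl hx)
  have e₃ := intervalIntegral.integral_sub (i₁ hx hy) (i₂ hx hy)
  rw [h₁.P_eq y hy, h₁.P_eq x hx, h₂.P_eq y hy, h₂.P_eq x hx]
  have e₄ : ∫ s in x..y, (g₁ s - g₂ s - (m₁ s - m₂ s))
      = ∫ s in x..y, (((g₁ s - m₁ s) - B s) - ((g₂ s - m₂ s) - B s)) := by
    congr 1; ext s; ring
  rw [e₄]
  linarith

/-- The terms `±P / r²` cancel in the sum of the two equations; what remains, `4 / r + a (1/m -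
1/g)`, is integrated from `ε₀`. -/
theorem enthalpy_add (hε₀ : 0 < ε₀) (h : IsFirstOrderPair ε₀ j a B η₀ g m P) {r : ℝ}
    (hr : r ∈ Icc ε₀ 1) :
    enthalpy j (g r) + enthalpy j (m r)
      = enthalpy j 1 + enthalpy j η₀ + 4 * (Real.log r - Real.log ε₀)
        + a * ∫ s in ε₀..r, (1 / m s - 1 / g s) := by
  have hc : ContinuousOn (fun r => enthalpy j (g r) + enthalpy j (m r) - 4 * Real.log r)
      (Icc ε₀ 1) :=
    ((h.continuousOn_g.enthalpy_comp h.one_le_g).add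
      (h.continuousOn_m.enthalpy_comp fun r hr => (h.one_lt_m r hr).le)).sub
      (continuousOn_const.mul (Real.continuousOn_log.mono fun r hr => by
        have := hr.1; simp; linarith))
  have hd : ∀ r ∈ Ioo ε₀ 1, HasDerivAt
      (fun r => enthalpy j (g r) + enthalpy j (m r) - 4 * Real.log r)
      (a * (1 / m r - 1 / g r)) r := by
    intro r hr
    have hr₀ : 0 < r := hε₀.trans hr.1
    convert! ((h.hasDerivAt_g r hr).add (h.hasDerivAt_m r hr)).sub
      ((Real.hasDerivAt_log hr₀.ne').const_mul 4) using 1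
    field_simp
    ring
  have hi : ContinuousOn (fun s => a * (1 / m s - 1 / g s)) (Icc ε₀ 1) :=
    continuousOn_const.mul ((h.continuousOn_m.one_div_of_one_le
      fun r hr => (h.one_lt_m r hr).le).sub (h.continuousOn_g.one_div_of_one_le h.one_le_g))
  have hsub : Icc ε₀ r ⊆ Icc ε₀ 1 := Icc_subset_Icc_right hr.2
  have e := intervalIntegral.integral_eq_sub_of_hasDerivAt_of_le hr.1 (hc.mono hsub)
    (fun x hx => hd x ⟨hx.1, hx.2.trans_le hr.2⟩)
    (hi.intervalIntegrable_of_Icc_subset (left_mem_Icc.2 (hr.1.trans hr.2)) hr)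
  rw [intervalIntegral.integral_const_mul, h.g_left, h.m_left] at e
  linarith

/-- The integral is the increment of `P₁ - P₂` over the component. Its sign follows from those of
the derivative of `F(g₁) - F(g₂)` at the two ends. -/
theorem integral_component_nonpos (hε₀ : 0 < ε₀) (hj₀ : 0 ≤ j) (hj₁ : j ≤ 1)
    (h₁ : IsFirstOrderPair ε₀ j a B η₀ g₁ m₁ P₁) (h₂ : IsFirstOrderPair ε₀ j a B η₀ g₂ m₂ P₂)
    {α β : ℝ} (hαβ : α < β) (hα : ε₀ ≤ α) (hβ : β ≤ 1) (hlt : ∀ r ∈ Ioo α β, g₂ r < g₁ r)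
    (eα : g₁ α = g₂ α) (eβ : g₁ β = g₂ β) :
    ∫ s in Ioo α β, (g₁ s - g₂ s - (m₁ s - m₂ s)) ≤ 0 := by
  have hsub : Icc α β ⊆ Icc ε₀ 1 := Icc_subset_Icc hα hβ
  have hα' : α ∈ Icc ε₀ 1 := hsub (left_mem_Icc.2 hαβ.le)
  have hβ' : β ∈ Icc ε₀ 1 := hsub (right_mem_Icc.2 hαβ.le)
  have hU : ContinuousOn (fun r => enthalpy j (g₁ r) - enthalpy j (g₂ r)) (Icc α β) :=
    ((h₁.continuousOn_g.enthalpy_comp h₁.one_le_g).sub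
      (h₂.continuousOn_g.enthalpy_comp h₂.one_le_g)).mono hsub
  have hφ : ContinuousOn (fun r => (P₁ r - P₂ r) / r ^ 2 - a * (1 / g₁ r - 1 / g₂ r))
      (Icc α β) := by
    refine ContinuousOn.mono (((h₁.continuousOn_P.sub h₂.continuousOn_P).div
      (continuousOn_id.pow 2) fun r hr => ?_).sub (continuousOn_const.mul
      ((h₁.continuousOn_g.one_div_of_one_le h₁.one_le_g).sub
      (h₂.continuousOn_g.one_div_of_one_le h₂.one_le_g)))) hsub
    have := hr.1
    have : 0 < r := by linarith
    simpa using this.ne'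
  have hd : ∀ r ∈ Ioo α β, HasDerivAt (fun r => enthalpy j (g₁ r) - enthalpy j (g₂ r))
      ((P₁ r - P₂ r) / r ^ 2 - a * (1 / g₁ r - 1 / g₂ r)) r := by
    intro r hr
    have hr' : r ∈ Ioo ε₀ 1 := ⟨hα.trans_lt hr.1, hr.2.trans_le hβ⟩
    convert! (h₁.hasDerivAt_g r hr').sub (h₂.hasDerivAt_g r hr') using 1
    ring
  have hpos : ∀ r ∈ Ioo α β, 0 < enthalpy j (g₁ r) - enthalpy j (g₂ r) := by
    intro r hr
    have hr' := hsub (Ioo_subset_Icc_self hr)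
    exact sub_pos.2 (enthalpy_strictMonoOn hj₀ hj₁ (h₂.one_le_g r hr') (h₁.one_le_g r hr')
      (hlt r hr))
  have n₁ := deriv_nonneg_of_pos_right hαβ hU hφ hd (by simp [eα]) hpos
  have n₂ := deriv_nonpos_of_pos_left hαβ hU hφ hd (by simp [eβ]) hpos
  -- Since `g₁ = g₂` at both ends, the relaxation terms vanish there for every `a`; no smallness is
  -- needed at this point.
  simp only [eα, eβ, sub_self, mul_zero, sub_zero] at n₁ n₂
  have hα₀ : 0 < α := by linarith
  have hβ₀ : 0 < β := by linarith
  have p₁ : 0 ≤ P₁ α - P₂ α := by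
    by_contra! hn
    exact absurd n₁ (not_le.2 (div_neg_of_neg_of_pos hn (by positivity)))
  have p₂ : P₁ β - P₂ β ≤ 0 := by
    by_contra! hn
    exact absurd n₂ (not_le.2 (div_pos hn (by positivity)))
  rw [← integral_Ioc_eq_integral_Ioo, ← intervalIntegral.integral_of_le hαβ.le,
    ← h₁.P_sub h₂ hα' hβ']
  linarith

theorem isOpen_lt (h₁ : IsFirstOrderPair ε₀ j a B η₀ g₁ m₁ P₁)
    (h₂ : IsFirstOrderPair ε₀ j a B η₀ g₂ m₂ P₂) : IsOpen {r ∈ Ioo ε₀ 1 | g₂ r < g₁ r} := by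
  have h := ((h₁.continuousOn_g.fun_sub h₂.continuousOn_g).mono
    Ioo_subset_Icc_self).isOpen_inter_preimage isOpen_Ioo (isOpen_Ioi (a := (0 : ℝ)))
  simpa [inter_def] using h

/-- The `L¹` comparison principle for the first component. -/
theorem setIntegral_lt_nonpos (hε₀ : 0 < ε₀) (hε₁ : ε₀ < 1) (hj₀ : 0 ≤ j) (hj₁ : j ≤ 1)
    (h₁ : IsFirstOrderPair ε₀ j a B η₀ g₁ m₁ P₁) (h₂ : IsFirstOrderPair ε₀ j a B η₀ g₂ m₂ P₂) :
    ∫ s in {r ∈ Ioo ε₀ 1 | g₂ r < g₁ r}, (g₁ s - g₂ s - (m₁ s - m₂ s)) ≤ 0 := by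
  have hsub : {r ∈ Ioo ε₀ 1 | g₂ r < g₁ r} ⊆ Ioo ε₀ 1 := fun r hr => hr.1
  refine setIntegral_nonpos_of_components (h₁.isOpen_lt h₂) hsub
    (((h₁.continuousOn_diff h₂).integrableOn_Icc).mono_set (hsub.trans Ioo_subset_Icc_self)) ?_
  intro α β hαβ hA hα hβ
  have hI : Icc α β ⊆ Icc ε₀ 1 := by
    rw [← closure_Ioo hαβ.ne, ← closure_Ioo hε₁.ne]
    exact closure_mono (hA.trans hsub)
  -- An end of a component is either a point of the open interval where `g₁ ≤ g₂`, or `ε₀` or `1`,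
  -- where both functions equal `1`. The reverse inequality passes to the limit from inside the
  -- component.
  have hend : ∀ x ∈ Icc α β, x ∉ {r ∈ Ioo ε₀ 1 | g₂ r < g₁ r} → g₁ x = g₂ x := by
    intro x hx hxA
    have hle : g₁ x ≤ g₂ x := by
      by_contra! hlt
      by_cases hxI : x ∈ Ioo ε₀ 1
      · exact hxA ⟨hxI, hlt⟩
      · rcases eq_or_lt_of_le (hI hx).1 with e | e
        · rw [← e, h₁.g_left, h₂.g_left] at hlt
          exact lt_irrefl _ hlt
        · rcases eq_or_lt_of_le (hI hx).2 with e' | e'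
          · rw [e', h₁.g_right, h₂.g_right] at hlt
            exact lt_irrefl _ hlt
          · exact hxI ⟨e, e'⟩
    refine le_antisymm hle ?_
    have hx' : x ∈ closure (Ioo α β) := by rwa [closure_Ioo hαβ.ne]
    exact ContinuousWithinAt.closure_le hx'
      ((h₂.continuousOn_g x (hI hx)).mono (Ioo_subset_Icc_self.trans hI))
      ((h₁.continuousOn_g x (hI hx)).mono (Ioo_subset_Icc_self.trans hI))
      fun y hy => (hA hy).2.le
  have hl := hI (left_mem_Icc.2 hαβ.le)
  have hr := hI (right_mem_Icc.2 hαβ.le)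
  exact h₁.integral_component_nonpos hε₀ hj₀ hj₁ h₂ hαβ hl.1 hr.2 (fun r hr => (hA hr).2)
    (hend α (left_mem_Icc.2 hαβ.le) hα) (hend β (right_mem_Icc.2 hαβ.le) hβ)

/-- The boundary terms in `enthalpy_add` agree for both solutions, and `x ↦ 1/x` is 1-Lipschitz on
`[1, ∞)`. -/
theorem abs_enthalpy_add_sub_le (hε₀ : 0 < ε₀) (ha : 0 ≤ a)
    (h₁ : IsFirstOrderPair ε₀ j a B η₀ g₁ m₁ P₁) (h₂ : IsFirstOrderPair ε₀ j a B η₀ g₂ m₂ P₂)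
    {r : ℝ} (hr : r ∈ Icc ε₀ 1) :
    |(enthalpy j (g₁ r) - enthalpy j (g₂ r)) + (enthalpy j (m₁ r) - enthalpy j (m₂ r))|
      ≤ a * ∫ s in Ioo ε₀ 1, (|g₁ s - g₂ s| + |m₁ s - m₂ s|) := by
  have hl : ε₀ ∈ Icc ε₀ 1 := left_mem_Icc.2 (hr.1.trans hr.2)
  have c := fun {g m P : ℝ → ℝ} (h : IsFirstOrderPair ε₀ j a B η₀ g m P) =>
    (h.continuousOn_m.one_div_of_one_le fun r hr => (h.one_lt_m r hr).le).fun_sub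
      (h.continuousOn_g.one_div_of_one_le h.one_le_g)
  have e : (enthalpy j (g₁ r) - enthalpy j (g₂ r)) + (enthalpy j (m₁ r) - enthalpy j (m₂ r))
      = a * ∫ s in ε₀..r, ((1 / m₁ s - 1 / g₁ s) - (1 / m₂ s - 1 / g₂ s)) := by
    rw [intervalIntegral.integral_sub ((c h₁).intervalIntegrable_of_Icc_subset hl hr)
      ((c h₂).intervalIntegrable_of_Icc_subset hl hr)]
    linarith [h₁.enthalpy_add hε₀ hr, h₂.enthalpy_add hε₀ hr]
  rw [e, abs_mul, abs_of_nonneg ha]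
  refine mul_le_mul_of_nonneg_left ?_ ha
  have hcd : ContinuousOn (fun s => |g₁ s - g₂ s| + |m₁ s - m₂ s|) (Icc ε₀ 1) :=
    (h₁.continuousOn_g.sub h₂.continuousOn_g).abs.add
      (h₁.continuousOn_m.sub h₂.continuousOn_m).abs
  have hinv : ∀ x y : ℝ, 1 ≤ x → 1 ≤ y → |1 / x - 1 / y| ≤ |x - y| := by
    intro x y hx hy
    have : 1 / x - 1 / y = (y - x) / (x * y) := by
      have : 0 < x := by linarith
      have : 0 < y := by linarith
      field_simp
    rw [this, abs_div, abs_sub_comm, abs_of_nonneg (a := x * y) (by nlinarith)]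
    exact div_le_self (abs_nonneg _) (by nlinarith)
  calc |∫ s in ε₀..r, ((1 / m₁ s - 1 / g₁ s) - (1 / m₂ s - 1 / g₂ s))|
      ≤ ∫ s in ε₀..r, |(1 / m₁ s - 1 / g₁ s) - (1 / m₂ s - 1 / g₂ s)| :=
        intervalIntegral.abs_integral_le_integral_abs hr.1
    _ ≤ ∫ s in ε₀..r, (|g₁ s - g₂ s| + |m₁ s - m₂ s|) := by
        refine intervalIntegral.integral_mono_on hr.1
          (((c h₁).sub (c h₂)).abs.intervalIntegrable_of_Icc_subset hl hr)
          (hcd.intervalIntegrable_of_Icc_subset hl hr) fun s hs => ?_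
        have hs' : s ∈ Icc ε₀ 1 := ⟨hs.1, hs.2.trans hr.2⟩
        have b₁ := hinv _ _ (h₁.one_le_g s hs') (h₂.one_le_g s hs')
        have b₂ := hinv _ _ (h₁.one_lt_m s hs').le (h₂.one_lt_m s hs').le
        have : (1 / m₁ s - 1 / g₁ s) - (1 / m₂ s - 1 / g₂ s)
            = (1 / m₁ s - 1 / m₂ s) - (1 / g₁ s - 1 / g₂ s) := by ring
        rw [this]
        exact (abs_sub _ _).trans (by linarith)
    _ = ∫ s in Ioo ε₀ r, (|g₁ s - g₂ s| + |m₁ s - m₂ s|) := by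
        rw [intervalIntegral.integral_of_le hr.1, integral_Ioc_eq_integral_Ioo]
    _ ≤ _ := setIntegral_mono_set (hcd.integrableOn_Icc.mono_set Ioo_subset_Icc_self)
        (Filter.Eventually.of_forall fun s => by positivity)
        (Ioo_subset_Ioo_right hr.2).eventuallyLE

/-- The core estimate. With `w = a (d + e)` it shows `d ≤ K w` by comparison on the sets `A`, `A'`,
then `e ≤ K d + K w` from the control of `F(g) + F(m)`; smallness closes the loop. -/
theorem eqOn_of_abs_sub_le (hε₀ : 0 < ε₀) (hε₁ : ε₀ < 1) (hj₀ : 0 ≤ j) (hj₁ : j ≤ 1) (ha : 0 ≤ a)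
    (h₁ : IsFirstOrderPair ε₀ j a B η₀ g₁ m₁ P₁) (h₂ : IsFirstOrderPair ε₀ j a B η₀ g₂ m₂ P₂)
    {K : ℝ} (hK : 0 ≤ K)
    (hm : ∀ r ∈ Icc ε₀ 1, |m₁ r - m₂ r| ≤ K * |enthalpy j (m₁ r) - enthalpy j (m₂ r)|)
    (hsmall : (K ^ 2 + 2 * K) * a < 1) :
    EqOn g₁ g₂ (Icc ε₀ 1) ∧ EqOn m₁ m₂ (Icc ε₀ 1) ∧ EqOn P₁ P₂ (Icc ε₀ 1) := by
  set d := ∫ s in Ioo ε₀ 1, |g₁ s - g₂ s|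
  set e := ∫ s in Ioo ε₀ 1, |m₁ s - m₂ s|
  have hcg : ContinuousOn (fun s => |g₁ s - g₂ s|) (Icc ε₀ 1) :=
    (h₁.continuousOn_g.sub h₂.continuousOn_g).abs
  have hcm : ContinuousOn (fun s => |m₁ s - m₂ s|) (Icc ε₀ 1) :=
    (h₁.continuousOn_m.sub h₂.continuousOn_m).abs
  have hig := hcg.integrableOn_Icc.mono_set (μ := volume) Ioo_subset_Icc_self
  have him := hcm.integrableOn_Icc.mono_set (μ := volume) Ioo_subset_Icc_self
  have hd₀ : 0 ≤ d := integral_nonneg fun s => abs_nonneg _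
  have he₀ : 0 ≤ e := integral_nonneg fun s => abs_nonneg _
  have hW : ∀ r ∈ Icc ε₀ 1,
      |(enthalpy j (g₁ r) - enthalpy j (g₂ r)) + (enthalpy j (m₁ r) - enthalpy j (m₂ r))|
        ≤ a * (d + e) := by
    intro r hr
    have := h₁.abs_enthalpy_add_sub_le hε₀ ha h₂ hr
    rwa [integral_add hig him] at this
  set w := a * (d + e)
  have hw₀ : 0 ≤ w := by positivity
  have hmono := (enthalpy_strictMonoOn hj₀ hj₁).monotoneOn
  set A := {r ∈ Ioo ε₀ 1 | g₂ r < g₁ r}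
  set A' := {r ∈ Ioo ε₀ 1 | g₁ r < g₂ r}
  have hA : IsOpen A := h₁.isOpen_lt h₂
  have hA' : IsOpen A' := h₂.isOpen_lt h₁
  have n₁ := h₁.setIntegral_lt_nonpos hε₀ hε₁ hj₀ hj₁ h₂
  have n₂ := h₂.setIntegral_lt_nonpos hε₀ hε₁ hj₀ hj₁ h₁
  -- On `A` the increment of `F(g)` is nonnegative, so that of `F(m)` is at most `w` and `m₁ - m₂ ≤
  -- K w`; `A'` is symmetric. Only this one-sided bound is needed, so `d` is estimated without `e`
  -- except through `w`.
  have hbound : ∀ r ∈ Ioo ε₀ 1, |g₁ r - g₂ r|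
      ≤ A.indicator (fun s => g₁ s - g₂ s - (m₁ s - m₂ s)) r
        + A'.indicator (fun s => g₂ s - g₁ s - (m₂ s - m₁ s)) r + K * w := by
    intro r hr
    have hr' := Ioo_subset_Icc_self hr
    have q₁ := h₁.one_le_g r hr'
    have q₂ := h₂.one_le_g r hr'
    have q₃ := (h₁.one_lt_m r hr').le
    have q₄ := (h₂.one_lt_m r hr').le
    have hWr := abs_le.1 (hW r hr')
    rcases lt_trichotomy (g₁ r) (g₂ r) with h | h | h
    · have hn : r ∉ A := fun hrA => lt_asymm h hrA.2
      have hy : r ∈ A' := ⟨hr, h⟩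
      rw [indicator_of_notMem hn, indicator_of_mem hy, abs_of_neg (by linarith)]
      have hU := hmono q₁ q₂ h.le
      have : m₂ r - m₁ r ≤ K * w := by
        rcases le_total (m₂ r) (m₁ r) with hle | hle
        · have : 0 ≤ K * w := by positivity
          linarith
        · have hb := hm r hr'
          have hV := hmono q₃ q₄ hle
          rw [abs_of_nonpos (by linarith), abs_of_nonpos (by linarith)] at hb
          have : K * -(enthalpy j (m₁ r) - enthalpy j (m₂ r)) ≤ K * w :=
            mul_le_mul_of_nonneg_left (by linarith) hK
          linarith
      linarith
    · have hn : r ∉ A := fun hrA => (ne_of_lt hrA.2) h.symm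
      have hn' : r ∉ A' := fun hrA => (ne_of_lt hrA.2) h
      rw [indicator_of_notMem hn, indicator_of_notMem hn', h]
      simpa using by positivity
    · have hn : r ∉ A' := fun hrA => lt_asymm h hrA.2
      have hy : r ∈ A := ⟨hr, h⟩
      rw [indicator_of_notMem hn, indicator_of_mem hy, abs_of_pos (by linarith)]
      have hU := hmono q₂ q₁ h.le
      have : m₁ r - m₂ r ≤ K * w := by
        rcases le_total (m₁ r) (m₂ r) with hle | hle
        · have : 0 ≤ K * w := by positivity
          linarith
        · have hb := hm r hr'
          have hV := hmono q₄ q₃ hle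
          rw [abs_of_nonneg (by linarith), abs_of_nonneg (by linarith)] at hb
          have : K * (enthalpy j (m₁ r) - enthalpy j (m₂ r)) ≤ K * w :=
            mul_le_mul_of_nonneg_left (by linarith) hK
          linarith
      linarith
  have hi₁ : IntegrableOn (A.indicator fun s => g₁ s - g₂ s - (m₁ s - m₂ s)) (Ioo ε₀ 1) :=
    ((h₁.continuousOn_diff h₂).integrableOn_Icc.mono_set Ioo_subset_Icc_self).indicator
      hA.measurableSet
  have hi₂ : IntegrableOn (A'.indicator fun s => g₂ s - g₁ s - (m₂ s - m₁ s)) (Ioo ε₀ 1) :=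
    ((h₂.continuousOn_diff h₁).integrableOn_Icc.mono_set Ioo_subset_Icc_self).indicator
      hA'.measurableSet
  -- The interval has length `1 - ε₀ ≤ 1`.
  have hconst : ∀ c : ℝ, 0 ≤ c → ∫ _ in Ioo ε₀ 1, c ≤ c := by
    intro c hc
    rw [setIntegral_const]
    simp only [Measure.real, Real.volume_Ioo, smul_eq_mul]
    rw [ENNReal.toReal_ofReal (by linarith)]
    nlinarith
  have hic : ∀ c : ℝ, IntegrableOn (fun _ : ℝ => c) (Ioo ε₀ 1) := fun c =>
    integrableOn_const (by simp)
  have hd : d ≤ K * w := by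
    have h := setIntegral_mono_on hig ((hi₁.add hi₂).add (hic (K * w))) measurableSet_Ioo hbound
    have e₁ : ∫ s in Ioo ε₀ 1, (A.indicator (fun s => g₁ s - g₂ s - (m₁ s - m₂ s)) s
        + A'.indicator (fun s => g₂ s - g₁ s - (m₂ s - m₁ s)) s + K * w)
        = (∫ s in A, (g₁ s - g₂ s - (m₁ s - m₂ s))) + (∫ s in A', (g₂ s - g₁ s - (m₂ s - m₁ s)))
          + ∫ _ in Ioo ε₀ 1, K * w := by
      rw [integral_add (Integrable.fun_add hi₁ hi₂) (hic _), integral_add hi₁ hi₂,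
        setIntegral_indicator hA.measurableSet, setIntegral_indicator hA'.measurableSet,
        inter_eq_right.2 (show A ⊆ Ioo ε₀ 1 from fun r hr => hr.1),
        inter_eq_right.2 (show A' ⊆ Ioo ε₀ 1 from fun r hr => hr.1)]
    have h' : d ≤ _ := h
    simp only [Pi.add_apply] at h'
    rw [e₁] at h'
    linarith [hconst (K * w) (by positivity)]
  have he : e ≤ K * d + K * w := by
    have h := setIntegral_mono_on him ((hig.const_mul K).add (hic (K * w))) measurableSet_Ioo
      (fun r hr => by
        have hr' := Ioo_subset_Icc_self hr
        have b₁ := abs_enthalpy_sub_le hj₀ hj₁ (h₁.one_le_g r hr') (h₂.one_le_g r hr')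
        have b₂ := hW r hr'
        have b₃ : |enthalpy j (m₁ r) - enthalpy j (m₂ r)| ≤ |g₁ r - g₂ r| + w := by
          have := abs_sub ((enthalpy j (g₁ r) - enthalpy j (g₂ r))
            + (enthalpy j (m₁ r) - enthalpy j (m₂ r))) (enthalpy j (g₁ r) - enthalpy j (g₂ r))
          rw [add_sub_cancel_left] at this
          linarith
        show |m₁ r - m₂ r| ≤ K * |g₁ r - g₂ r| + K * w
        exact (hm r hr').trans ((mul_le_mul_of_nonneg_left b₃ hK).trans (by linarith)))
    have h' : e ≤ _ := h
    simp only [Pi.add_apply] at h'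
    rw [integral_add (hig.const_mul K) (hic _), integral_const_mul] at h'
    linarith [hconst (K * w) (by positivity)]
  have hsum : d + e = 0 := by
    have : d + e ≤ (K ^ 2 + 2 * K) * a * (d + e) := by
      have : K * d ≤ K * (K * w) := mul_le_mul_of_nonneg_left hd hK
      calc d + e ≤ K * w + (K * (K * w) + K * w) := by linarith
        _ = _ := by ring
    nlinarith
  have hzero : ∀ f : ℝ → ℝ, ContinuousOn (fun s => |f s|) (Icc ε₀ 1) →
      ∫ s in Ioo ε₀ 1, |f s| = 0 → ∀ r ∈ Icc ε₀ 1, f r = 0 := by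
    intro f hf h0
    have hae := (setIntegral_eq_zero_iff_of_nonneg_ae
      (Filter.Eventually.of_forall fun s => abs_nonneg (f s))
      (hf.integrableOn_Icc.mono_set Ioo_subset_Icc_self)).1 h0
    have := Measure.eqOn_Icc_of_ae_eq volume hε₁.ne
      (by rwa [restrict_Ioo_eq_restrict_Icc] at hae) hf continuousOn_const
    intro r hr
    exact abs_eq_zero.1 (this hr)
  have hg : EqOn g₁ g₂ (Icc ε₀ 1) := fun r hr =>
    sub_eq_zero.1 (hzero (fun s => g₁ s - g₂ s) hcg (by linarith) r hr)
  have hmm : EqOn m₁ m₂ (Icc ε₀ 1) := fun r hr =>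
    sub_eq_zero.1 (hzero (fun s => m₁ s - m₂ s) hcm (by linarith) r hr)
  refine ⟨hg, hmm, ?_⟩
  -- Once `g₁ = g₂`, the equation for `F(g)` determines `P` inside the interval.
  have hP : EqOn P₁ P₂ (Ioo ε₀ 1) := by
    intro r hr
    have hr₀ : 0 < r := hε₀.trans hr.1
    have hev : (fun r => enthalpy j (g₁ r)) =ᶠ[nhds r] fun r => enthalpy j (g₂ r) := by
      filter_upwards [Ioo_mem_nhds hr.1 hr.2] with x hx
      rw [hg (Ioo_subset_Icc_self hx)]
    have hu := (h₁.hasDerivAt_g r hr).unique ((h₂.hasDerivAt_g r hr).congr_of_eventuallyEq hev)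
    rw [hg (Ioo_subset_Icc_self hr)] at hu
    have hu' : (P₁ r + 2 * r) / r ^ 2 = (P₂ r + 2 * r) / r ^ 2 := by linarith
    field_simp at hu'
    linarith
  have := hP.of_subset_closure h₁.continuousOn_P h₂.continuousOn_P Ioo_subset_Icc_self
    (by rw [closure_Ioo hε₁.ne])
  exact this

end IsFirstOrderPair

/-! ### Weak derivatives on an interval: primitives and du Bois-Reymond. -/

theorem exists_Ioo_of_isCompact {a b : ℝ} {K : Set ℝ} (hK : IsCompact K) (hne : K.Nonempty)
    (hsub : K ⊆ Ioo a b) : ∃ x y, a < x ∧ y < b ∧ x < y ∧ K ⊆ Ioo x y := by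
  obtain ⟨p, hp, hpm⟩ := hK.exists_isLeast hne
  obtain ⟨q, hq, hqm⟩ := hK.exists_isGreatest hne
  have h₁ := hsub hp
  have h₂ := hsub hq
  have h₃ := hpm hq
  refine ⟨(a + p) / 2, (q + b) / 2, by linarith [h₁.1], by linarith [h₂.2],
    by linarith [h₁.1, h₂.2], fun z hz => ⟨?_, ?_⟩⟩
  · linarith [hpm hz, h₁.1]
  · linarith [hqm hz, h₂.2]

theorem MeasureTheory.LocallyIntegrableOn.intervalIntegrable_of_mem_Ioo {f : ℝ → ℝ} {a b x y : ℝ}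
    (hf : LocallyIntegrableOn f (Ioo a b)) (hx : x ∈ Ioo a b) (hy : y ∈ Ioo a b) :
    IntervalIntegrable f volume x y :=
  (hf.integrableOn_compact_subset (ordConnected_Ioo.uIcc_subset hx hy)
    isCompact_uIcc).intervalIntegrable

theorem MeasureTheory.LocallyIntegrableOn.continuousOn_primitive {f : ℝ → ℝ} {a b c : ℝ}
    (hf : LocallyIntegrableOn f (Ioo a b)) (hc : c ∈ Ioo a b) :
    ContinuousOn (fun x => ∫ t in c..x, f t) (Ioo a b) := by
  intro x hx
  obtain ⟨p, q, hap, hqb, hpq, hK⟩ := exists_Ioo_of_isCompact (K := {c, x}) (by simp) (by simp)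
    (insert_subset hc (singleton_subset_iff.2 hx))
  have hcp : c ∈ Ioo p q := hK (by simp)
  have hxp : x ∈ Ioo p q := hK (by simp)
  have hi : IntervalIntegrable f volume p q := hf.intervalIntegrable_of_mem_Ioo
    ⟨hap, hpq.trans hqb⟩ ⟨hap.trans hpq, hqb⟩
  have hcu : c ∈ uIcc p q := by rw [uIcc_of_le hpq.le]; exact Ioo_subset_Icc_self hcp
  have hcont := (hi.absolutelyContinuousOnInterval_intervalIntegral hcu).continuousOn
  rw [uIcc_of_le hpq.le] at hcont
  exact (hcont.continuousAt (Icc_mem_nhds hxp.1 hxp.2)).continuousWithinAt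

theorem MeasureTheory.LocallyIntegrableOn.integrableOn_mul_of_tsupport_subset {f φ : ℝ → ℝ}
    {a b : ℝ} (hf : LocallyIntegrableOn f (Ioo a b)) (hφ : Continuous φ)
    (hc : HasCompactSupport φ) (hs : tsupport φ ⊆ Ioo a b) :
    IntegrableOn (fun x => f x * φ x) (Ioo a b) := by
  have h := (hf.integrableOn_compact_subset hs hc).mul_continuousOn hφ.continuousOn hc
  have hsupp : Function.support (fun x => f x * φ x) ⊆ tsupport φ := fun x hx =>
    subset_tsupport φ (right_ne_zero_of_mul hx)
  exact ((integrableOn_iff_integrable_of_support_subset hsupp).1 h).integrableOn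

theorem setIntegral_Ioo_eq_intervalIntegral {F : ℝ → ℝ} {a b x y : ℝ} (hx : a ≤ x) (hy : y ≤ b)
    (hxy : x ≤ y) (h : ∀ t, t ∉ Ioo x y → F t = 0) :
    ∫ t in Ioo a b, F t = ∫ t in x..y, F t := by
  rw [intervalIntegral.integral_of_le hxy, integral_Ioc_eq_integral_Ioo]
  exact setIntegral_eq_of_subset_of_forall_sdiff_eq_zero measurableSet_Ioo
    (Ioo_subset_Ioo hx hy) fun t ht => h t ht.2

theorem ContDiff.absolutelyContinuousOnInterval' {φ : ℝ → ℝ} (hφ : ContDiff ℝ ∞ φ) (x y : ℝ) :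
    AbsolutelyContinuousOnInterval φ x y :=
  (hφ.contDiffOn.of_le (by exact_mod_cast le_top)).absolutelyContinuousOnInterval

/-- Integration by parts of a primitive against a test function. -/
theorem integral_primitive_mul_deriv {f : ℝ → ℝ} {a b c : ℝ}
    (hf : LocallyIntegrableOn f (Ioo a b)) (hc : c ∈ Ioo a b) {φ : ℝ → ℝ}
    (hφ : ContDiff ℝ ∞ φ) (hφc : HasCompactSupport φ) (hs : tsupport φ ⊆ Ioo a b) :
    ∫ x in Ioo a b, (∫ t in c..x, f t) * deriv φ x = -∫ x in Ioo a b, f x * φ x := by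
  -- The base point `c` is added to the support so that one compact interval in `(a, b)` contains
  -- both; there `f` is integrable and its primitive absolutely continuous.
  obtain ⟨x, y, hax, hyb, hxy, hK⟩ := exists_Ioo_of_isCompact (hφc.insert c) ⟨c, by simp⟩
    (insert_subset hc hs)
  have hcx : c ∈ Ioo x y := hK (mem_insert _ _)
  have hz : ∀ t, t ∉ Ioo x y → φ t = 0 := fun t ht =>
    image_eq_zero_of_notMem_tsupport fun h => ht (hK (mem_insert_of_mem _ h))
  have hz' : ∀ t, t ∉ Ioo x y → deriv φ t = 0 := fun t ht =>
    image_eq_zero_of_notMem_tsupport fun h =>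
      ht (hK (mem_insert_of_mem _ (tsupport_deriv_subset h)))
  rw [setIntegral_Ioo_eq_intervalIntegral hax.le hyb.le hxy.le fun t ht => by rw [hz' t ht, mul_zero],
    setIntegral_Ioo_eq_intervalIntegral hax.le hyb.le hxy.le fun t ht => by rw [hz t ht, mul_zero]]
  have hi : IntervalIntegrable f volume x y := hf.intervalIntegrable_of_mem_Ioo
    ⟨hax, hxy.trans hyb⟩ ⟨hax.trans hxy, hyb⟩
  have hcu : c ∈ uIcc x y := by rw [uIcc_of_le hxy.le]; exact Ioo_subset_Icc_self hcx
  rw [(hi.absolutelyContinuousOnInterval_intervalIntegral hcu).integral_mul_deriv_eq_deriv_mul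
    (hφ.absolutelyContinuousOnInterval' x y), hz x (by simp), hz y (by simp)]
  simp only [mul_zero, sub_zero, zero_sub]
  congr 1
  apply intervalIntegral.integral_congr_ae
  filter_upwards [hi.ae_hasDerivAt_integral] with t ht htm
  rw [(ht (uIoc_subset_uIcc htm) c hcu).deriv]

/-- A test function of integral zero is the derivative of a test function. -/
theorem exists_deriv_eq_of_integral_eq_zero {a b : ℝ} {χ : ℝ → ℝ} (hχ : ContDiff ℝ ∞ χ)
    (hχc : HasCompactSupport χ) (hs : tsupport χ ⊆ Ioo a b) (h0 : ∫ x in Ioo a b, χ x = 0) :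
    ∃ φ : ℝ → ℝ, ContDiff ℝ ∞ φ ∧ HasCompactSupport φ ∧ tsupport φ ⊆ Ioo a b ∧ deriv φ = χ := by
  rcases (tsupport χ).eq_empty_or_nonempty with he | hne
  · have : χ = 0 := tsupport_eq_empty_iff.1 he
    exact ⟨0, contDiff_const, HasCompactSupport.zero, by simp [tsupport], by rw [this]; simp⟩
  obtain ⟨x, y, hax, hyb, hxy, hK⟩ := exists_Ioo_of_isCompact hχc hne hs
  have hz : ∀ t, t ∉ Ioo x y → χ t = 0 := fun t ht =>
    image_eq_zero_of_notMem_tsupport fun h => ht (hK h)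
  have hd : ∀ r, HasDerivAt (fun r => ∫ t in x..r, χ t) (χ r) r := fun r =>
    intervalIntegral.integral_hasDerivAt_right (hχ.continuous.intervalIntegrable _ _)
      (hχ.continuous.stronglyMeasurableAtFilter _ _) hχ.continuous.continuousAt
  have hderiv : deriv (fun r => ∫ t in x..r, χ t) = χ := funext fun r => (hd r).deriv
  have hsupp : Function.support (fun r => ∫ t in x..r, χ t) ⊆ Icc x y := by
    intro r hr
    by_contra hn
    apply hr
    by_cases hrx : x ≤ r
    · have hyr : y < r := by
        by_contra! h
        exact hn ⟨hrx, h⟩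
      have e₁ : ∫ t in y..r, χ t = 0 := by
        rw [← intervalIntegral.integral_zero (a := y) (b := r) (μ := volume) (E := ℝ)]
        apply intervalIntegral.integral_congr
        intro t ht
        rw [uIcc_of_le hyr.le] at ht
        exact hz t fun h => absurd h.2 (not_lt.2 ht.1)
      show ∫ t in x..r, χ t = 0
      rw [← intervalIntegral.integral_add_adjacent_intervals
        (hχ.continuous.intervalIntegrable x y) (hχ.continuous.intervalIntegrable y r), e₁,
        ← setIntegral_Ioo_eq_intervalIntegral hax.le hyb.le hxy.le hz, h0, add_zero]
    · push Not at hrx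
      show ∫ t in x..r, χ t = 0
      rw [← intervalIntegral.integral_zero (a := x) (b := r) (μ := volume) (E := ℝ)]
      apply intervalIntegral.integral_congr
      intro t ht
      rw [uIcc_of_ge hrx.le] at ht
      exact hz t fun h => absurd h.1 (not_lt.2 ht.2)
  refine ⟨fun r => ∫ t in x..r, χ t, ?_, HasCompactSupport.of_support_subset_isCompact
    isCompact_Icc hsupp, ?_, hderiv⟩
  · rw [contDiff_infty_iff_deriv, hderiv]
    exact ⟨fun r => (hd r).differentiableAt, hχ⟩
  · exact (closure_minimal hsupp isClosed_Icc).trans fun r hr =>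
      ⟨hax.trans_le hr.1, hr.2.trans_lt hyb⟩

/-- The lemma of du Bois-Reymond: a function whose weak derivative vanishes is constant. -/
theorem exists_ae_eq_const_of_integral_mul_deriv_eq_zero {h : ℝ → ℝ} {a b : ℝ} (hab : a < b)
    (hh : LocallyIntegrableOn h (Ioo a b))
    (h0 : ∀ φ : ℝ → ℝ, ContDiff ℝ ∞ φ → HasCompactSupport φ → tsupport φ ⊆ Ioo a b →
      ∫ x in Ioo a b, h x * deriv φ x = 0) :
    ∃ k : ℝ, ∀ᵐ x ∂volume.restrict (Ioo a b), h x = k := by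
  let ψ₀ : ContDiffBump ((a + b) / 2) := ⟨(b - a) / 8, (b - a) / 4, by linarith, by linarith⟩
  let ψ : ℝ → ℝ := ψ₀.normed volume
  have hψ : ContDiff ℝ ∞ ψ := ψ₀.contDiff_normed
  have hψc : HasCompactSupport ψ := ψ₀.hasCompactSupport_normed
  have hψs : tsupport ψ ⊆ Ioo a b := by
    show tsupport (ψ₀.normed volume) ⊆ Ioo a b
    rw [ψ₀.tsupport_normed_eq, Real.closedBall_eq_Icc]
    intro z hz
    show a < z ∧ z < b
    have h₁ : (a + b) / 2 - (b - a) / 4 ≤ z := hz.1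
    have h₂ : z ≤ (a + b) / 2 + (b - a) / 4 := hz.2
    constructor <;> linarith
  have hint : ∀ χ : ℝ → ℝ, tsupport χ ⊆ Ioo a b → ∫ x in Ioo a b, χ x = ∫ x, χ x := fun χ hs =>
    setIntegral_eq_integral_of_forall_compl_eq_zero fun x hx =>
      image_eq_zero_of_notMem_tsupport fun h => hx (hs h)
  have hψ1 : ∫ x, ψ x = 1 := ψ₀.integral_normed
  set k := ∫ x in Ioo a b, h x * ψ x
  refine ⟨k, ?_⟩
  have hk : LocallyIntegrableOn (fun x => h x - k) (Ioo a b) :=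
    hh.sub ((continuous_const (y := k)).locallyIntegrable.locallyIntegrableOn _)
  have := isOpen_Ioo.ae_eq_zero_of_integral_contDiff_smul_eq_zero hk (μ := volume) ?_
  · rw [ae_restrict_iff' measurableSet_Ioo]
    filter_upwards [this] with x hx hxm
    linarith [hx hxm]
  intro χ hχ hχc hχs
  have hχi : Integrable χ := hχ.continuous.integrable_of_hasCompactSupport hχc
  have hψi : Integrable ψ := hψ.continuous.integrable_of_hasCompactSupport hψc
  have hts : tsupport (fun x => χ x - (∫ t, χ t) * ψ x) ⊆ tsupport χ ∪ tsupport ψ := by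
    refine closure_minimal (fun x hx => ?_) ((isClosed_tsupport χ).union (isClosed_tsupport ψ))
    by_contra hn
    rw [mem_union, not_or] at hn
    exact hx (by simp only [image_eq_zero_of_notMem_tsupport hn.1,
      image_eq_zero_of_notMem_tsupport hn.2, mul_zero, sub_zero])
  have hts' := hts.trans (union_subset hχs hψs)
  -- Subtracting `(∫ χ) ψ`, with `∫ ψ = 1`, makes the integral zero. Testing with its antiderivative
  -- yields `∫ h χ = k ∫ χ`.
  obtain ⟨φ, hφ, hφc, hφs, hφd⟩ := exists_deriv_eq_of_integral_eq_zero (a := a) (b := b)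
    (χ := fun x => χ x - (∫ t, χ t) * ψ x) (hχ.sub (contDiff_const.mul hψ))
    ((hχc.union hψc).of_isClosed_subset (isClosed_tsupport _) hts) hts'
    (by rw [hint _ hts', integral_sub hχi (hψi.const_mul _), integral_const_mul, hψ1]; ring)
  have e := h0 φ hφ hφc hφs
  rw [hφd] at e
  have i₁ := hh.integrableOn_mul_of_tsupport_subset hχ.continuous hχc hχs
  have i₂ := hh.integrableOn_mul_of_tsupport_subset hψ.continuous hψc hψs
  have e₁ : ∫ x in Ioo a b, h x * (χ x - (∫ t, χ t) * ψ x)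
      = (∫ x in Ioo a b, h x * χ x) - (∫ t, χ t) * k := by
    rw [← integral_const_mul, ← integral_sub i₁ (i₂.const_mul _)]
    congr 1; ext x; ring
  rw [e₁] at e
  have e₂ : ∫ x, χ x • (h x - k) = ∫ x in Ioo a b, (h x * χ x - k * χ x) := by
    rw [← setIntegral_eq_integral_of_forall_compl_eq_zero (s := Ioo a b)]
    · congr 1; ext x; simp only [smul_eq_mul]; ring
    · intro x hx
      rw [image_eq_zero_of_notMem_tsupport fun h => hx (hχs h), zero_smul]
  rw [e₂, integral_sub i₁ (hχi.integrableOn.const_mul k), integral_const_mul, hint χ hχs]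
  linarith

namespace IsWeakDeriv

variable {a b : ℝ} {f f' : ℝ → ℝ}

theorem ae_eq_primitive (hf : IsWeakDeriv a b f f') {c : ℝ} (hc : c ∈ Ioo a b) :
    ∃ k : ℝ, ∀ᵐ x ∂volume.restrict (Ioo a b), f x = k + ∫ t in c..x, f' t := by
  obtain ⟨hf₁, hf₂, hf₃⟩ := hf
  have hG : ContinuousOn (fun x => ∫ t in c..x, f' t) (Ioo a b) :=
    hf₂.continuousOn_primitive hc
  have hGl : LocallyIntegrableOn (fun x => ∫ t in c..x, f' t) (Ioo a b) :=
    hG.locallyIntegrableOn measurableSet_Ioo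
  obtain ⟨k, hk⟩ := exists_ae_eq_const_of_integral_mul_deriv_eq_zero (hc.1.trans hc.2)
    (hf₁.sub hGl) fun φ hφ hφc hφs => by
      have hds := (tsupport_deriv_subset (f := φ) (𝕜 := ℝ)).trans hφs
      have hdc : Continuous (deriv φ) := hφ.continuous_deriv (by simp)
      have e : ∀ x, (f - fun x => ∫ t in c..x, f' t) x * deriv φ x
          = f x * deriv φ x - (∫ t in c..x, f' t) * deriv φ x := fun x => by
        simp only [Pi.sub_apply]; ring
      simp only [e]
      rw [integral_sub (hf₁.integrableOn_mul_of_tsupport_subset hdc hφc.deriv hds)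
        (hGl.integrableOn_mul_of_tsupport_subset hdc hφc.deriv hds), hf₃ φ hφ hφc hφs,
        integral_primitive_mul_deriv hf₂ hc hφ hφc hφs, sub_self]
  refine ⟨k, ?_⟩
  filter_upwards [hk] with x hx
  simp only [Pi.sub_apply] at hx
  linarith

theorem sub_eq_integral (hf : IsWeakDeriv a b f f') (hcont : ContinuousOn f (Ioo a b)) {x y : ℝ}
    (hx : x ∈ Ioo a b) (hy : y ∈ Ioo a b) : f y - f x = ∫ t in x..y, f' t := by
  obtain ⟨k, hk⟩ := hf.ae_eq_primitive hx
  have hG : ContinuousOn (fun z => k + ∫ t in x..z, f' t) (Ioo a b) := 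
    continuousOn_const.add (hf.2.1.continuousOn_primitive hx)
  have heq := Measure.eqOn_open_of_ae_eq hk isOpen_Ioo hcont hG
  have h₁ := heq hx
  have h₂ := heq hy
  simp only [intervalIntegral.integral_same, add_zero] at h₁ h₂
  linarith

end IsWeakDeriv

/-! ### From weak solutions to the first order system. -/

/-- The chain rule for an absolutely continuous function and the enthalpy. -/
theorem enthalpy_sub_eq_integral {j a b : ℝ} {f f' : ℝ → ℝ} (hj₀ : 0 ≤ j) (hj₁ : j ≤ 1)
    (hf' : LocallyIntegrableOn f' (Ioo a b))
    (hf : ∀ x ∈ Ioo a b, ∀ y ∈ Ioo a b, f y - f x = ∫ t in x..y, f' t)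
    (h1 : ∀ x ∈ Ioo a b, 1 ≤ f x) {x y : ℝ} (hx : x ∈ Ioo a b) (hy : y ∈ Ioo a b) :
    enthalpy j (f y) - enthalpy j (f x)
      = ∫ t in x..y, (1 / f t - j ^ 2 / f t ^ 3) * f' t := by
  have hu : uIcc x y ⊆ Ioo a b := ordConnected_Ioo.uIcc_subset hx hy
  have hi := hf'.intervalIntegrable_of_mem_Ioo hx hy
  have hG := hi.absolutelyContinuousOnInterval_intervalIntegral (c := x) left_mem_uIcc
  have hAC : AbsolutelyContinuousOnInterval (fun t => enthalpy j (f t)) x y := by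
    rw [absolutelyContinuousOnInterval_iff] at hG ⊢
    intro ε hε
    obtain ⟨δ, hδ, h⟩ := hG ε hε
    -- `F` is 1-Lipschitz on `[1, ∞)`, so the `δ` of the primitive of `f'` also serves for the
    -- composition.
    refine ⟨δ, hδ, fun E hE hE' => (Finset.sum_le_sum fun i hi => ?_).trans_lt (h E hE hE')⟩
    have hm := hE.1 i hi
    have m₁ := hu hm.1
    have m₂ := hu hm.2
    rw [Real.dist_eq, Real.dist_eq, ← hf _ hx _ m₁, ← hf _ hx _ m₂]
    simpa using abs_enthalpy_sub_le hj₀ hj₁ (h1 _ m₁) (h1 _ m₂)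
  rw [← hAC.integral_deriv_eq_sub]
  apply intervalIntegral.integral_congr_ae
  filter_upwards [hi.ae_hasDerivAt_integral] with t ht htm
  have htu := uIoc_subset_uIcc htm
  have hd := (ht htu x left_mem_uIcc).const_add (f x)
  have hft : HasDerivAt f (f' t) t := by
    refine hd.congr_of_eventuallyEq ?_
    filter_upwards [isOpen_Ioo.mem_nhds (hu htu)] with z hz
    linarith [hf x hx z hz]
  exact ((hasDerivAt_enthalpy (by linarith [h1 t (hu htu)])).comp t hft).deriv

theorem hasDerivAt_of_sub_eq_integral {a b : ℝ} {u φ : ℝ → ℝ} (hφ : ContinuousOn φ (Ioo a b))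
    (h : ∀ x ∈ Ioo a b, ∀ y ∈ Ioo a b, u y - u x = ∫ t in x..y, φ t) {r : ℝ}
    (hr : r ∈ Ioo a b) : HasDerivAt u (φ r) r := by
  have hd : HasDerivAt (fun y => u r + ∫ t in r..y, φ t) (φ r) r :=
    (intervalIntegral.integral_hasDerivAt_right (by simp)
      (hφ.stronglyMeasurableAtFilter isOpen_Ioo r hr)
      (hφ.continuousAt (isOpen_Ioo.mem_nhds hr))).const_add _
  refine hd.congr_of_eventuallyEq ?_
  filter_upwards [isOpen_Ioo.mem_nhds hr] with z hz
  linarith [h r hr z hz]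

/-- Smooth functions with compact support in `(a, b)` belong to `H¹₀(a, b)`. -/
theorem isH10_of_contDiff {a b : ℝ} {φ : ℝ → ℝ} (hφ : ContDiff ℝ ∞ φ)
    (hc : HasCompactSupport φ) (hs : tsupport φ ⊆ Ioo a b) : IsH10 a b φ (deriv φ) where
  continuousOn := hφ.continuous.continuousOn
  weakDeriv := by
    have hd : Continuous (deriv φ) := hφ.continuous_deriv (by simp)
    refine ⟨hφ.continuous.locallyIntegrable.locallyIntegrableOn _,
      hd.locallyIntegrable.locallyIntegrableOn _, fun ψ hψ hψc hψs => ?_⟩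
    have hint : ∀ χ : ℝ → ℝ, (∀ x, x ∉ tsupport ψ → χ x = 0) →
        ∫ x in Ioo a b, χ x = ∫ x, χ x := fun χ h =>
      setIntegral_eq_integral_of_forall_compl_eq_zero fun x hx => h x fun hm => hx (hψs hm)
    rw [hint _ fun x hx => by
        rw [image_eq_zero_of_notMem_tsupport fun h => hx (tsupport_deriv_subset h), mul_zero],
      hint _ fun x hx => by rw [image_eq_zero_of_notMem_tsupport hx, mul_zero]]
    have hψd : Continuous (deriv ψ) := hψ.continuous_deriv (by simp)
    exact integral_mul_deriv_eq_deriv_mul_of_integrable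
      (fun x _ => (hφ.differentiable (by simp) x).hasDerivAt)
      (fun x _ => (hψ.differentiable (by simp) x).hasDerivAt)
      ((hφ.continuous.mul hψd).integrable_of_hasCompactSupport hc.mul_right)
      ((hd.mul hψ.continuous).integrable_of_hasCompactSupport hψc.mul_left)
      ((hφ.continuous.mul hψ.continuous).integrable_of_hasCompactSupport hc.mul_right)
  memLp := ((hφ.continuous_deriv (by simp)).memLp_of_hasCompactSupport hc.deriv).restrict _
  left_zero := image_eq_zero_of_notMem_tsupport fun h => lt_irrefl a (hs h).1
  right_zero := image_eq_zero_of_notMem_tsupport fun h => lt_irrefl b (hs h).2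

theorem MeasureTheory.IntegrableOn.continuousOn_primitive_Icc {f : ℝ → ℝ} {a b c : ℝ}
    (hf : IntegrableOn f (Ioo a b)) (hc : c ∈ Icc a b) :
    ContinuousOn (fun x => ∫ t in c..x, f t) (Icc a b) := by
  have hab : a ≤ b := hc.1.trans hc.2
  have := intervalIntegral.continuousOn_primitive_interval'
    (hf.intervalIntegrable_of_mem_Icc (left_mem_Icc.2 hab) (right_mem_Icc.2 hab))
    (by rwa [uIcc_of_le hab])
  rwa [uIcc_of_le hab] at this

theorem IsWeakDeriv.eq_add_integral {a b : ℝ} {f f' : ℝ → ℝ} (hab : a < b)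
    (hf : IsWeakDeriv a b f f') (hcont : ContinuousOn f (Icc a b))
    (hf' : IntegrableOn f' (Ioo a b)) {r : ℝ} (hr : r ∈ Icc a b) :
    f r = f a + ∫ t in a..r, f' t := by
  have hl := left_mem_Icc.2 hab.le
  have hc : (a + b) / 2 ∈ Ioo a b := ⟨by linarith, by linarith⟩
  have hc' := Ioo_subset_Icc_self hc
  have h : EqOn f (fun r => f ((a + b) / 2) + ∫ t in (a + b) / 2..r, f' t) (Icc a b) :=
    EqOn.of_subset_closure (s := Ioo a b)
      (fun r hr => by
        have := hf.sub_eq_integral (hcont.mono Ioo_subset_Icc_self) hc hr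
        show f r = f ((a + b) / 2) + ∫ t in (a + b) / 2..r, f' t
        linarith) hcont
      (continuousOn_const.add (hf'.continuousOn_primitive_Icc hc')) Ioo_subset_Icc_self
      (by rw [closure_Ioo hab.ne])
  have e := intervalIntegral.integral_interval_sub_left
    (hf'.intervalIntegrable_of_mem_Icc hc' hr) (hf'.intervalIntegrable_of_mem_Icc hc' hl)
  have h₁ := h hr
  have h₂ := h hl
  simp only at h₁ h₂
  linarith

theorem one_le_of_one_lt_Ioo {ε₀ : ℝ} {f : ℝ → ℝ} (h : ∀ r ∈ Ioo ε₀ 1, 1 < f r)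
    (hl : f ε₀ = 1) (hr : f 1 = 1) : ∀ r ∈ Icc ε₀ 1, 1 ≤ f r := by
  intro r hrm
  rcases eq_or_lt_of_le hrm.1 with e | e
  · rw [← e, hl]
  · rcases eq_or_lt_of_le hrm.2 with e' | e'
    · rw [e', hr]
    · exact (h r ⟨e, e'⟩).le

/-- The flux of a weak solution of a second order equation is the primitive of the right-hand
side, and the enthalpy is continuously differentiable. -/
theorem exists_flux_of_weak {ε₀ j a : ℝ} {f f' h : ℝ → ℝ} (hε₀ : 0 < ε₀) (hε₁ : ε₀ < 1)
    (hj₀ : 0 ≤ j) (hj₁ : j ≤ 1) (hf : ContinuousOn f (Icc ε₀ 1)) (h1 : ∀ r ∈ Icc ε₀ 1, 1 ≤ f r)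
    (hw : IsWeakDeriv ε₀ 1 f f') (hh : IntegrableOn h (Ioo ε₀ 1))
    (heq : ∀ φ φr : ℝ → ℝ, IsH10 ε₀ 1 φ φr →
      (∫ r in Ioo ε₀ 1, (r ^ 2 * (1 / f r - j ^ 2 / f r ^ 3) * f' r
          + a * (r ^ 2 / f r) - 2 * r) * φr r) + ∫ r in Ioo ε₀ 1, h r * φ r = 0) :
    ∃ P : ℝ → ℝ, ContinuousOn P (Icc ε₀ 1) ∧
      (∀ r ∈ Icc ε₀ 1, P r = P ε₀ + ∫ s in ε₀..r, h s) ∧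
      ∀ r ∈ Ioo ε₀ 1,
        HasDerivAt (fun r => enthalpy j (f r)) ((P r + 2 * r) / r ^ 2 - a / f r) r := by
  have hfI := hf.mono Ioo_subset_Icc_self
  have hne : ∀ r ∈ Ioo ε₀ 1, f r ≠ 0 := fun r hr => by
    linarith [h1 r (Ioo_subset_Icc_self hr)]
  have hcoef : ContinuousOn (fun r => r ^ 2 * (1 / f r - j ^ 2 / f r ^ 3)) (Ioo ε₀ 1) :=
    (continuousOn_id.pow 2).mul ((continuousOn_const.div hfI hne).sub
      (continuousOn_const.div (hfI.pow 3) fun r hr => pow_ne_zero 3 (hne r hr)))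
  have hlow : ContinuousOn (fun r => a * (r ^ 2 / f r) - 2 * r) (Ioo ε₀ 1) :=
    (continuousOn_const.mul ((continuousOn_id.pow 2).div hfI hne)).sub
      (continuousOn_const.mul continuousOn_id)
  have hX : IsWeakDeriv ε₀ 1 (fun r => r ^ 2 * (1 / f r - j ^ 2 / f r ^ 3) * f' r
      + a * (r ^ 2 / f r) - 2 * r) h := by
    refine ⟨?_, hh.locallyIntegrableOn, fun φ hφ hφc hφs => ?_⟩
    · have h₁ := (hw.2.1.continuousOn_mul hcoef isOpen_Ioo.isLocallyClosed).add
        (hlow.locallyIntegrableOn (μ := volume) measurableSet_Ioo)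
      convert! h₁ using 1
      ext r
      simp only [Pi.add_apply]
      ring
    · linarith [heq φ (deriv φ) (isH10_of_contDiff hφ hφc hφs)]
  have hc : (ε₀ + 1) / 2 ∈ Ioo ε₀ 1 := ⟨by linarith, by linarith⟩
  have hc' := Ioo_subset_Icc_self hc
  have hl : ε₀ ∈ Icc ε₀ 1 := left_mem_Icc.2 hε₁.le
  -- The weak equation says that the flux has weak derivative `h`. Its continuous representative is
  -- `P`; solving the flux for `(1/f - j²/f³) f'` exhibits the derivative of `F(f)` as a continuous
  -- function.
  obtain ⟨k, hk⟩ := hX.ae_eq_primitive hc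
  have hP : ContinuousOn (fun r => k + ∫ t in (ε₀ + 1) / 2..r, h t) (Icc ε₀ 1) :=
    continuousOn_const.add (hh.continuousOn_primitive_Icc hc')
  refine ⟨fun r => k + ∫ t in (ε₀ + 1) / 2..r, h t, hP, fun r hr => ?_, fun r hr => ?_⟩
  · have e := intervalIntegral.integral_interval_sub_left
      (hh.intervalIntegrable_of_mem_Icc hc' hr) (hh.intervalIntegrable_of_mem_Icc hc' hl)
    simp only
    linarith
  · have hpos : ∀ r ∈ Ioo ε₀ 1, r ≠ 0 := fun r hr => (hε₀.trans hr.1).ne'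
    refine hasDerivAt_of_sub_eq_integral (φ := fun r =>
      ((k + ∫ t in (ε₀ + 1) / 2..r, h t) + 2 * r) / r ^ 2 - a / f r) ?_ ?_ hr
    · exact (((hP.mono Ioo_subset_Icc_self).add (continuousOn_const.mul continuousOn_id)).div
        (continuousOn_id.pow 2) fun r hr => pow_ne_zero 2 (hpos r hr)).sub
        (continuousOn_const.div hfI hne)
    · intro x hx y hy
      rw [enthalpy_sub_eq_integral hj₀ hj₁ hw.2.1
        (fun x hx y hy => hw.sub_eq_integral hfI hx hy)
        (fun x hx => h1 x (Ioo_subset_Icc_self hx)) hx hy]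
      apply intervalIntegral.integral_congr_ae
      rw [ae_restrict_iff' measurableSet_Ioo] at hk
      filter_upwards [hk] with t ht htm
      have htI : t ∈ Ioo ε₀ 1 := ordConnected_Ioo.uIcc_subset hx hy (uIoc_subset_uIcc htm)
      rw [← ht htI]
      have h₁ := hpos t htI
      have h₂ := hne t htI
      field_simp
      ring

theorem MeasureTheory.MemLp.integrableOn_of_top {f : ℝ → ℝ} {a b : ℝ}
    (hf : MemLp f ∞ (volume.restrict (Ioo a b))) : IntegrableOn f (Ioo a b) :=
  hf.integrable le_top

theorem mul_relaxRate_nonneg {j : ℝ} (hj₀ : 0 ≤ j) (τ : ℝ≥0∞) : 0 ≤ j * relaxRate τ :=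
  mul_nonneg hj₀ ENNReal.toReal_nonneg

/-- The right-hand sides of the two second order equations add up to zero, so their fluxes `P` and
`Q` have a constant sum `C`. The first order system requires `C = 0`, and this is what compatibility
expresses. -/
theorem IsSubsonicPair.exists_isFirstOrderPair {ε₀ j η₀ : ℝ} {τ : ℝ≥0∞} {B g m : ℝ → ℝ}
    (hε₀ : 0 < ε₀) (hε₁ : ε₀ < 1) (hj₀ : 0 ≤ j) (hj₁ : j ≤ 1)
    (hB : MemLp B ∞ (volume.restrict (Ioo ε₀ 1))) (h : IsSubsonicPair ε₀ j τ B η₀ g m)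
    (hcomp : IsCompatible ε₀ j τ η₀ g m) :
    ∃ P, IsFirstOrderPair ε₀ j (j * relaxRate τ) B η₀ g m P := by
  have hg1 := one_le_of_one_lt_Ioo h.subsonic_g h.g_left h.g_right
  have hm1 : ∀ r ∈ Icc ε₀ 1, 1 ≤ m r := fun r hr => (h.subsonic_m r hr).le
  have hcg := h.continuousOn_g
  have hcm := h.m_memW2Infty.1
  have hBi := hB.integrableOn_of_top
  have hl : ε₀ ∈ Icc ε₀ 1 := left_mem_Icc.2 hε₁.le
  have hr1 : (1 : ℝ) ∈ Icc ε₀ 1 := right_mem_Icc.2 hε₁.le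
  have hi₁ : IntegrableOn (fun r => g r - m r - B r) (Ioo ε₀ 1) :=
    Integrable.sub ((hcg.sub hcm).integrableOn_Icc.mono_set Ioo_subset_Icc_self) hBi
  have hi₂ : IntegrableOn (fun r => m r + B r - g r) (Ioo ε₀ 1) :=
    Integrable.sub (Integrable.add (hcm.integrableOn_Icc.mono_set Ioo_subset_Icc_self) hBi)
      (hcg.integrableOn_Icc.mono_set Ioo_subset_Icc_self)
  obtain ⟨gr, hgw, -, hgeq⟩ := h.weak_g
  obtain ⟨mr, hmw, hmeq⟩ := h.weak_m
  obtain ⟨P, hPc, hPe, hPd⟩ := exists_flux_of_weak hε₀ hε₁ hj₀ hj₁ hcg hg1 hgw hi₁ hgeq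
  -- The equation for `m` is the one for `g` with the sign of `a` reversed.
  obtain ⟨Q, -, hQe, hQd⟩ := exists_flux_of_weak (a := -(j * relaxRate τ)) hε₀ hε₁ hj₀ hj₁ hcm
    hm1 hmw hi₂ (by simpa only [neg_mul, ← sub_eq_add_neg] using hmeq)
  have hsum : ∀ r ∈ Icc ε₀ 1, Q r = (P ε₀ + Q ε₀) - P r := by
    intro r hr
    have e := intervalIntegral.integral_add (hi₁.intervalIntegrable_of_mem_Icc hl hr)
      (hi₂.intervalIntegrable_of_mem_Icc hl hr)
    have e₀ : ∀ s, g s - m s - B s + (m s + B s - g s) = 0 := fun s => by ring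
    simp only [e₀, intervalIntegral.integral_zero] at e
    linarith [hPe r hr, hQe r hr]
  set C := P ε₀ + Q ε₀
  have hC : C = 0 := by
    have hne : ∀ r ∈ Icc ε₀ 1, r ≠ 0 := fun r hr => (hε₀.trans_le hr.1).ne'
    have hinv : ContinuousOn (fun s => 1 / m s - 1 / g s) (Icc ε₀ 1) :=
      (hcm.one_div_of_one_le hm1).sub (hcg.one_div_of_one_le hg1)
    -- The term `C / r` compensates the contribution `(P + Q)/r² = C/r²`. Integrated over the whole
    -- interval, the identity differs from the compatibility condition by `C (1 - 1/ε₀)`.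
    have e := intervalIntegral.integral_eq_sub_of_hasDerivAt_of_le hε₁.le
      (f := fun r => enthalpy j (g r) + enthalpy j (m r) - 4 * Real.log r + C * r⁻¹)
      (f' := fun r => j * relaxRate τ * (1 / m r - 1 / g r))
      ((((hcg.enthalpy_comp hg1).add (hcm.enthalpy_comp hm1)).sub
        (continuousOn_const.mul (Real.continuousOn_log.mono hne))).add
        (continuousOn_const.mul (continuousOn_inv₀.mono hne)))
      (fun r hr => by
        have hr₀ := hne r (Ioo_subset_Icc_self hr)
        convert! (((hPd r hr).add (hQd r hr)).sub
          ((Real.hasDerivAt_log hr₀).const_mul 4)).add ((hasDerivAt_inv hr₀).const_mul C) using 1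
        rw [hsum r (Ioo_subset_Icc_self hr)]
        field_simp
        ring)
      ((continuousOn_const.mul hinv).intervalIntegrable_of_Icc_subset hl hr1)
    rw [intervalIntegral.integral_const_mul, intervalIntegral.integral_of_le hε₁.le,
      integral_Ioc_eq_integral_Ioo] at e
    have e' : ∫ r in Ioo ε₀ 1, (1 / g r - 1 / m r) = -∫ r in Ioo ε₀ 1, (1 / m r - 1 / g r) := by
      rw [← integral_neg]
      congr 1; ext r; ring
    simp only [IsCompatible, e'] at hcomp
    simp only [h.g_left, h.g_right, h.m_left, Real.log_one, inv_one] at e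
    have hz : C * (1 - ε₀⁻¹) = 0 := by linarith
    have : 1 - ε₀⁻¹ ≠ 0 := by
      have := (one_lt_inv₀ hε₀).2 hε₁
      linarith
    exact (mul_eq_zero.1 hz).resolve_right this
  refine ⟨P, ⟨hcg, hcm, hPc, hg1, h.subsonic_m, h.g_left, h.g_right, h.m_left, hPd,
    fun r hr => ?_, hBi, hPe⟩⟩
  convert! hQd r hr using 1
  rw [hsum r (Ioo_subset_Icc_self hr), hC]
  ring

/-- Division of the momentum equation by `ρ` gives the derivative of `ln ρ + J²/(2ρ²)`, and `F(r²
ρ)` is this plus `2 ln r`. The current `j'` may be `j` or `-j`, which covers both species. -/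
theorem hasDerivAt_enthalpy_of_momentum {ε₀ j j' κ : ℝ} {ρ ρr q E : ℝ → ℝ} (hε₀ : 0 < ε₀)
    (hj : j' ^ 2 = j ^ 2) (hρ : ContinuousOn ρ (Icc ε₀ 1)) (hE : ContinuousOn E (Icc ε₀ 1))
    (h1 : ∀ r ∈ Icc ε₀ 1, 1 ≤ r ^ 2 * ρ r) (hw : IsWeakDeriv ε₀ 1 ρ ρr)
    (hq : IsWeakDeriv ε₀ 1 (fun r => (j' / r ^ 2) ^ 2 / ρ r ^ 2) q)
    (heq : ∀ᵐ r ∂(volume.restrict (Ioo ε₀ 1)),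
      1 / 2 * ρ r * q r + ρr r = ρ r * E r - j' / r ^ 2 * κ) {r : ℝ} (hr : r ∈ Ioo ε₀ 1) :
    HasDerivAt (fun r => enthalpy j (r ^ 2 * ρ r))
      ((r ^ 2 * E r + 2 * r) / r ^ 2 - j' * κ / (r ^ 2 * ρ r)) r := by
  have hρ1 : ∀ r ∈ Icc ε₀ 1, 1 ≤ ρ r := by
    intro r hr
    have hr₀ : 0 < r := hε₀.trans_le hr.1
    have hp : 0 < ρ r := pos_of_mul_pos_right (one_pos.trans_le (h1 r hr)) (by positivity)
    have : r ^ 2 ≤ 1 := pow_le_one₀ hr₀.le hr.2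
    nlinarith [h1 r hr]
  have hρI := hρ.mono Ioo_subset_Icc_self
  have hEI := hE.mono Ioo_subset_Icc_self
  have hne : ∀ r ∈ Ioo ε₀ 1, ρ r ≠ 0 := fun r hr => by
    linarith [hρ1 r (Ioo_subset_Icc_self hr)]
  have hr0 : ∀ r ∈ Ioo ε₀ 1, r ≠ 0 := fun r hr => (hε₀.trans hr.1).ne'
  have hJ : ContinuousOn (fun r : ℝ => j' / r ^ 2) (Ioo ε₀ 1) :=
    continuousOn_const.div (continuousOn_id.pow 2) fun r hr => pow_ne_zero 2 (hr0 r hr)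
  have hwc : ContinuousOn (fun r => (j' / r ^ 2) ^ 2 / ρ r ^ 2) (Ioo ε₀ 1) :=
    (hJ.pow 2).div (hρI.pow 2) fun r hr => pow_ne_zero 2 (hne r hr)
  have hd : HasDerivAt (fun r => enthalpy 0 (ρ r) + 1 / 2 * ((j' / r ^ 2) ^ 2 / ρ r ^ 2))
      (E r - j' / r ^ 2 * κ / ρ r) r := by
    refine hasDerivAt_of_sub_eq_integral (φ := fun r => E r - j' / r ^ 2 * κ / ρ r)
      (hEI.sub ((hJ.mul continuousOn_const).div hρI hne)) (fun x hx y hy => ?_) hr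
    have hu : uIcc x y ⊆ Ioo ε₀ 1 := ordConnected_Ioo.uIcc_subset hx hy
    -- For `j = 0` the enthalpy is the logarithm. The chain rule applies because `r ≤ 1` and `r² ρ ≥
    -- 1` give `ρ ≥ 1`.
    have e₁ := enthalpy_sub_eq_integral (j := 0) le_rfl zero_le_one hw.2.1
      (fun x hx y hy => hw.sub_eq_integral hρI hx hy)
      (fun x hx => hρ1 x (Ioo_subset_Icc_self hx)) hx hy
    have e₂ := hq.sub_eq_integral hwc hx hy
    have e₃ : ∀ t ∈ uIcc x y, (1 / ρ t - 0 ^ 2 / ρ t ^ 3) * ρr t = ρr t / ρ t := fun t _ => by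
      ring
    rw [intervalIntegral.integral_congr e₃] at e₁
    have i₁ : IntervalIntegrable (fun t => ρr t / ρ t) volume x y := by
      have hinv : ContinuousOn (fun t => (ρ t)⁻¹) (uIcc x y) :=
        (hρI.mono hu).inv₀ fun t ht => hne t (hu ht)
      simpa only [div_eq_mul_inv] using
        (hw.2.1.intervalIntegrable_of_mem_Ioo hx hy).mul_continuousOn hinv
    have i₂ : IntervalIntegrable (fun t => 1 / 2 * q t) volume x y :=
      (hq.2.1.intervalIntegrable_of_mem_Ioo hx hy).const_mul _
    have e₄ : ∫ t in x..y, (E t - j' / t ^ 2 * κ / ρ t)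
        = ∫ t in x..y, (ρr t / ρ t + 1 / 2 * q t) := by
      apply intervalIntegral.integral_congr_ae
      rw [ae_restrict_iff' measurableSet_Ioo] at heq
      filter_upwards [heq] with t ht htm
      have htI := hu (uIoc_subset_uIcc htm)
      have := ht htI
      have h₁ := hne t htI
      have h₂ : (ρ t * E t - j' / t ^ 2 * κ) / ρ t = E t - j' / t ^ 2 * κ / ρ t := by
        rw [sub_div, mul_div_cancel_left₀ _ h₁]
      rw [← h₂, ← this]
      field_simp
      ring
    rw [e₄, intervalIntegral.integral_add i₁ i₂, intervalIntegral.integral_const_mul, ← e₁, ← e₂]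
    ring
  have hlog := (Real.hasDerivAt_log (hr0 r hr)).const_mul 2
  have hev : (fun r => enthalpy j (r ^ 2 * ρ r)) =ᶠ[nhds r] fun r =>
      2 * Real.log r + (enthalpy 0 (ρ r) + 1 / 2 * ((j' / r ^ 2) ^ 2 / ρ r ^ 2)) := by
    filter_upwards [isOpen_Ioo.mem_nhds hr] with s hs
    have h₁ := hr0 s hs
    have h₂ := hne s hs
    simp only [enthalpy]
    rw [Real.log_mul (pow_ne_zero 2 h₁) h₂, Real.log_pow, ← hj]
    field_simp
    push_cast
    ring
  refine HasDerivAt.congr_of_eventuallyEq ?_ hev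
  convert! hlog.add hd using 1
  have h₁ := hr0 r hr
  have h₂ := hne r hr
  field_simp
  ring

theorem IsSubsonicRadialSolution.isFirstOrderPair {ε₀ j η₀ : ℝ} {τ : ℝ≥0∞} {b ρ n E : ℝ → ℝ}
    (hε₀ : 0 < ε₀) (hε₁ : ε₀ < 1) (hb : MemLp b ∞ (volume.restrict (Ioo ε₀ 1)))
    (h : IsSubsonicRadialSolution ε₀ j τ b η₀ ρ n E) :
    IsFirstOrderPair ε₀ j (j * relaxRate τ) (fun r => r ^ 2 * b r) η₀ (fun r => r ^ 2 * ρ r)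
      (fun r => r ^ 2 * n r) (fun r => r ^ 2 * E r) := by
  have hsq : ContinuousOn (fun r : ℝ => r ^ 2) (Icc ε₀ 1) := (continuous_pow 2).continuousOn
  have hρc := h.continuousOn_ρ
  have hnc := h.n_memW2Infty.1
  have hEc := h.continuousOn_E
  have hg1 : ∀ r ∈ Icc ε₀ 1, 1 ≤ r ^ 2 * ρ r :=
    one_le_of_one_lt_Ioo h.subsonic_ρ h.ρ_left h.ρ_right
  have hm1 : ∀ r ∈ Icc ε₀ 1, 1 ≤ r ^ 2 * n r := fun r hr => (h.subsonic_n r hr).le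
  have hbi : IntegrableOn (fun r => r ^ 2 * b r) (Ioo ε₀ 1) := by
    have hi : IntegrableOn b (Icc ε₀ 1) := by
      rw [integrableOn_Icc_iff_integrableOn_Ioo]
      exact hb.integrableOn_of_top
    exact (hi.continuousOn_mul hsq isCompact_Icc).mono_set Ioo_subset_Icc_self
  have hgc : ContinuousOn (fun r => r ^ 2 * ρ r) (Icc ε₀ 1) := hsq.mul hρc
  have hmc : ContinuousOn (fun r => r ^ 2 * n r) (Icc ε₀ 1) := hsq.mul hnc
  obtain ⟨ρr, q, hρw, hqw, hρe⟩ := h.momentum_ρ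
  obtain ⟨nr, p, hnw, hpw, hne⟩ := h.momentum_n
  refine ⟨hgc, hmc, hsq.mul hEc, hg1, h.subsonic_n, h.ρ_left, h.ρ_right, h.n_left,
    fun r hr => hasDerivAt_enthalpy_of_momentum hε₀ rfl hρc hEc hg1 hρw hqw hρe hr,
    fun r hr => ?_, hbi, fun r hr => ?_⟩
  · have hd := hasDerivAt_enthalpy_of_momentum (j := j) (j' := -j) (κ := relaxRate τ)
      (E := fun r => -E r) hε₀ (by ring) hnc hEc.neg hm1 hnw hpw
      (by simpa only [mul_neg, holeCurrent] using hne) hr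
    convert! hd using 1
    ring
  · have e : ∀ s, r ^ 2 * 0 + s ^ 2 * ρ s - s ^ 2 * n s - s ^ 2 * b s
        = s ^ 2 * (ρ s - n s - b s) := fun s => by ring
    simp only [mul_zero, zero_add] at e
    simp only [e]
    refine h.poisson.eq_add_integral hε₁ (hsq.mul hEc) ?_ hr
    simp only [← e]
    exact Integrable.sub ((hgc.sub hmc).integrableOn_Icc.mono_set Ioo_subset_Icc_self) hbi

/-! ### The constant `K` and the two uniqueness results. -/

namespace IsFirstOrderPair

variable {ε₀ j a η₀ : ℝ} {B g m P g₁ m₁ P₁ g₂ m₂ P₂ : ℝ → ℝ}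

/-- For `a = 0` the smallness condition is void, so `K` may depend on the solutions: the maxima of
`m₁`, `m₂` bound the values, and the minimum of `m₁` over a compact interval exceeds `1`. -/
theorem eqOn_of_zero (hε₀ : 0 < ε₀) (hε₁ : ε₀ < 1) (hj₀ : 0 ≤ j) (hj₁ : j ≤ 1)
    (h₁ : IsFirstOrderPair ε₀ j 0 B η₀ g₁ m₁ P₁) (h₂ : IsFirstOrderPair ε₀ j 0 B η₀ g₂ m₂ P₂) :
    EqOn g₁ g₂ (Icc ε₀ 1) ∧ EqOn m₁ m₂ (Icc ε₀ 1) ∧ EqOn P₁ P₂ (Icc ε₀ 1) := by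
  have hne : (Icc ε₀ 1).Nonempty := ⟨ε₀, left_mem_Icc.2 hε₁.le⟩
  obtain ⟨p, hp, hpmin⟩ := isCompact_Icc.exists_isMinOn hne h₁.continuousOn_m
  obtain ⟨q, -, hqmax⟩ := isCompact_Icc.exists_isMaxOn hne h₁.continuousOn_m
  obtain ⟨s, -, hsmax⟩ := isCompact_Icc.exists_isMaxOn hne h₂.continuousOn_m
  have hp1 := h₁.one_lt_m p hp
  have hM : 1 ≤ max (m₁ q) (m₂ s) := hp1.le.trans ((hqmax hp).trans (le_max_left _ _))
  have hc : 0 < m₁ p - 1 := by linarith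
  refine h₁.eqOn_of_abs_sub_le hε₀ hε₁ hj₀ hj₁ le_rfl h₂
    (K := 2 * max (m₁ q) (m₂ s) ^ 3 / (m₁ p - 1)) (by positivity) (fun r hr => ?_) (by simp)
  have b₁ := h₁.one_lt_m r hr
  have b₂ := h₂.one_lt_m r hr
  have b₃ : m₁ p ≤ m₁ r := hpmin hr
  refine abs_sub_le_mul_abs_enthalpy_sub hj₀ hj₁ b₁.le b₂.le
    ((hqmax hr).trans (le_max_left _ _)) ((hsmax hr).trans (le_max_right _ _)) hc ?_
  nlinarith

/-- An a priori bound that makes `K`, and hence `δ`, independent of the solution, `B`, `j` and `τ`.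
It follows from `enthalpy_add` by `F(g) ≥ F(1)` and `ln m ≤ F(m)`; the `2` collects the bound `1`
for `j²/(2η₀²)` and `1` for the term in `a`. -/
theorem m_le_exp (hε₀ : 0 < ε₀) (hj₀ : 0 ≤ j) (hj₁ : j ≤ 1) (ha₀ : 0 ≤ a) (ha₁ : a ≤ 1)
    (h : IsFirstOrderPair ε₀ j a B η₀ g m P) {r : ℝ} (hr : r ∈ Icc ε₀ 1) :
    m r ≤ Real.exp (Real.log η₀ - 4 * Real.log ε₀ + 2) := by
  have hl : ε₀ ∈ Icc ε₀ 1 := left_mem_Icc.2 (hr.1.trans hr.2)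
  have hm := h.one_lt_m r hr
  have hη : 1 < η₀ := h.m_left ▸ h.one_lt_m ε₀ hl
  have e := h.enthalpy_add hε₀ hr
  have hg : enthalpy j 1 ≤ enthalpy j (g r) :=
    (enthalpy_strictMonoOn hj₀ hj₁).monotoneOn self_mem_Ici (h.one_le_g r hr) (h.one_le_g r hr)
  have hlog : Real.log r ≤ 0 := Real.log_nonpos (hε₀.le.trans hr.1) hr.2
  have hmF : Real.log (m r) ≤ enthalpy j (m r) := by
    have : 0 ≤ j ^ 2 / (2 * m r ^ 2) := by positivity
    unfold enthalpy
    linarith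
  have hηF : enthalpy j η₀ ≤ Real.log η₀ + 1 := by
    have : j ^ 2 / (2 * η₀ ^ 2) ≤ 1 := by
      rw [div_le_one (by positivity)]
      nlinarith
    unfold enthalpy
    linarith
  have hint : ∫ s in ε₀..r, (1 / m s - 1 / g s) ≤ 1 := by
    have hcont : ContinuousOn (fun s => 1 / m s - 1 / g s) (Icc ε₀ 1) :=
      (h.continuousOn_m.one_div_of_one_le fun r hr => (h.one_lt_m r hr).le).sub
        (h.continuousOn_g.one_div_of_one_le h.one_le_g)
    have := intervalIntegral.integral_mono_on hr.1
      (hcont.intervalIntegrable_of_Icc_subset hl hr) (g := fun _ => (1 : ℝ)) (by simp)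
      (fun s hs => by
        have hs' : s ∈ Icc ε₀ 1 := ⟨hs.1, hs.2.trans hr.2⟩
        have h₁ : 1 / m s ≤ 1 := div_le_one_of_le₀ (h.one_lt_m s hs').le
          (by linarith [h.one_lt_m s hs'])
        have h₂ : 0 ≤ 1 / g s := div_nonneg one_pos.le (by linarith [h.one_le_g s hs'])
        linarith)
    simp only [intervalIntegral.integral_const, smul_eq_mul, mul_one] at this
    linarith [hr.2]
  have ha : a * ∫ s in ε₀..r, (1 / m s - 1 / g s) ≤ 1 :=
    (mul_le_mul_of_nonneg_left hint ha₀).trans (by linarith)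
  rw [← Real.log_le_iff_le_exp (by linarith)]
  linarith

/-- Uniqueness for the first order system with small `a = j / τ`, with an explicit threshold. -/
theorem eqOn_of_small (hε₀ : 0 < ε₀) (hε₁ : ε₀ < 1) (hj₀ : 0 ≤ j) (hj₁ : j ≤ 1) (ha₀ : 0 ≤ a)
    (ha₁ : a ≤ 1) {K : ℝ}
    (hK : K = 2 * Real.exp (Real.log η₀ - 4 * Real.log ε₀ + 2) ^ 3 / 3)
    (ha₂ : (K ^ 2 + 2 * K) * a < 1)
    (h₁ : IsFirstOrderPair ε₀ j a B η₀ g₁ m₁ P₁) (h₂ : IsFirstOrderPair ε₀ j a B η₀ g₂ m₂ P₂)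
    (hm : ∀ r ∈ Icc ε₀ 1, 4 ≤ m₁ r) :
    EqOn g₁ g₂ (Icc ε₀ 1) ∧ EqOn m₁ m₂ (Icc ε₀ 1) ∧ EqOn P₁ P₂ (Icc ε₀ 1) := by
  subst hK
  refine h₁.eqOn_of_abs_sub_le hε₀ hε₁ hj₀ hj₁ ha₀ h₂ (by positivity) (fun r hr => ?_) ha₂
  have b₁ := h₁.one_lt_m r hr
  have b₂ := h₂.one_lt_m r hr
  have b₃ := hm r hr
  exact abs_sub_le_mul_abs_enthalpy_sub hj₀ hj₁ b₁.le b₂.le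
    (h₁.m_le_exp hε₀ hj₀ hj₁ ha₀ ha₁ hr) (h₂.m_le_exp hε₀ hj₀ hj₁ ha₀ ha₁ hr) three_pos
    -- `2xy - x - y ≥ x - 1 ≥ 3` when `x ≥ 4` and `y ≥ 1`.
    (by nlinarith)

end IsFirstOrderPair

theorem EqOn.of_sq_mul {ε₀ : ℝ} (hε₀ : 0 < ε₀) {f₁ f₂ : ℝ → ℝ}
    (h : EqOn (fun r => r ^ 2 * f₁ r) (fun r => r ^ 2 * f₂ r) (Icc ε₀ 1)) :
    EqOn f₁ f₂ (Icc ε₀ 1) := fun _ hr =>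
  mul_left_cancel₀ (pow_ne_zero 2 (hε₀.trans_le hr.1).ne') (h hr)

theorem relaxRate_top : relaxRate ∞ = 0 := by simp [relaxRate]

theorem theorem3 (ε₀ : ℝ) (hε₀ : 0 < ε₀) (hε₁ : ε₀ < 1) :
    -- the case `τ = ∞`
    (∀ j : ℝ, 0 < j → j ≤ 1 → ∀ η₀ : ℝ,
      (∀ B : ℝ → ℝ, MemLp B ∞ (volume.restrict (Ioo ε₀ 1)) →
        ∀ g₁ m₁ g₂ m₂ : ℝ → ℝ,
          IsSubsonicPair ε₀ j ∞ B η₀ g₁ m₁ → IsCompatible ε₀ j ∞ η₀ g₁ m₁ →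
          IsSubsonicPair ε₀ j ∞ B η₀ g₂ m₂ → IsCompatible ε₀ j ∞ η₀ g₂ m₂ →
          EqOn g₁ g₂ (Icc ε₀ 1) ∧ EqOn m₁ m₂ (Icc ε₀ 1)) ∧
      (∀ b : ℝ → ℝ, MemLp b ∞ (volume.restrict (Ioo ε₀ 1)) →
        ∀ ρ₁ n₁ E₁ ρ₂ n₂ E₂ : ℝ → ℝ,
          IsSubsonicRadialSolution ε₀ j ∞ b η₀ ρ₁ n₁ E₁ →
          IsSubsonicRadialSolution ε₀ j ∞ b η₀ ρ₂ n₂ E₂ →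
          EqOn ρ₁ ρ₂ (Icc ε₀ 1) ∧ EqOn n₁ n₂ (Icc ε₀ 1) ∧ EqOn E₁ E₂ (Icc ε₀ 1))) ∧
    -- the case of small `j / τ`
    (∀ mlow : ℝ, 1 < mlow → ∀ η₀ : ℝ, ∃ δ : ℝ, 0 < δ ∧
      ∀ (j : ℝ) (τ : ℝ≥0∞), 0 < j → j ≤ 1 → 0 < τ → j * relaxRate τ ≤ δ →
        (∀ B : ℝ → ℝ, MemLp B ∞ (volume.restrict (Ioo ε₀ 1)) →
          ∀ g₁ m₁ g₂ m₂ : ℝ → ℝ,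
            IsSubsonicPair ε₀ j τ B η₀ g₁ m₁ → IsCompatible ε₀ j τ η₀ g₁ m₁ →
            (∀ r ∈ Icc ε₀ 1, mlow + 3 ≤ m₁ r) →
            IsSubsonicPair ε₀ j τ B η₀ g₂ m₂ → IsCompatible ε₀ j τ η₀ g₂ m₂ →
            EqOn g₁ g₂ (Icc ε₀ 1) ∧ EqOn m₁ m₂ (Icc ε₀ 1)) ∧
        (∀ b : ℝ → ℝ, MemLp b ∞ (volume.restrict (Ioo ε₀ 1)) →
          ∀ ρ₁ n₁ E₁ ρ₂ n₂ E₂ : ℝ → ℝ,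
            IsSubsonicRadialSolution ε₀ j τ b η₀ ρ₁ n₁ E₁ →
            (∀ r ∈ Icc ε₀ 1, mlow + 3 ≤ r ^ 2 * n₁ r) →
            IsSubsonicRadialSolution ε₀ j τ b η₀ ρ₂ n₂ E₂ →
            EqOn ρ₁ ρ₂ (Icc ε₀ 1) ∧ EqOn n₁ n₂ (Icc ε₀ 1) ∧ EqOn E₁ E₂ (Icc ε₀ 1))) := by
  refine ⟨fun j hj₀ hj₁ η₀ => ⟨fun B hB g₁ m₁ g₂ m₂ h₁ c₁ h₂ c₂ => ?_,
    fun b hb ρ₁ n₁ E₁ ρ₂ n₂ E₂ h₁ h₂ => ?_⟩, fun mlow hmlow η₀ => ?_⟩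
  · obtain ⟨P₁, f₁⟩ := h₁.exists_isFirstOrderPair hε₀ hε₁ hj₀.le hj₁ hB c₁
    obtain ⟨P₂, f₂⟩ := h₂.exists_isFirstOrderPair hε₀ hε₁ hj₀.le hj₁ hB c₂
    rw [relaxRate_top, mul_zero] at f₁ f₂
    have h := f₁.eqOn_of_zero hε₀ hε₁ hj₀.le hj₁ f₂
    exact ⟨h.1, h.2.1⟩
  · have f₁ := h₁.isFirstOrderPair hε₀ hε₁ hb
    have f₂ := h₂.isFirstOrderPair hε₀ hε₁ hb
    rw [relaxRate_top, mul_zero] at f₁ f₂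
    have h := f₁.eqOn_of_zero hε₀ hε₁ hj₀.le hj₁ f₂
    exact ⟨EqOn.of_sq_mul hε₀ h.1, EqOn.of_sq_mul hε₀ h.2.1, EqOn.of_sq_mul hε₀ h.2.2⟩
  · obtain ⟨K, hK⟩ : ∃ K, K = 2 * Real.exp (Real.log η₀ - 4 * Real.log ε₀ + 2) ^ 3 / 3 := ⟨_, rfl⟩
    have hK₀ : 0 < K := by rw [hK]; positivity
    -- The bound `1` is for `m_le_exp`; the other makes the contraction factor at most `1/2`.
    refine ⟨min 1 (1 / (2 * (K ^ 2 + 2 * K))), by positivity, fun j τ hj₀ hj₁ _ hδ => ?_⟩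
    have ha₀ := mul_relaxRate_nonneg hj₀.le τ
    have ha₁ := hδ.trans (min_le_left _ _)
    have ha₂ : (K ^ 2 + 2 * K) * (j * relaxRate τ) < 1 := by
      calc (K ^ 2 + 2 * K) * (j * relaxRate τ)
          ≤ (K ^ 2 + 2 * K) * (1 / (2 * (K ^ 2 + 2 * K))) := by
            gcongr
            exact hδ.trans (min_le_right _ _)
        _ = 1 / 2 := by field_simp
        _ < 1 := by norm_num
    refine ⟨fun B hB g₁ m₁ g₂ m₂ h₁ c₁ hm h₂ c₂ => ?_,
      fun b hb ρ₁ n₁ E₁ ρ₂ n₂ E₂ h₁ hn h₂ => ?_⟩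
    · obtain ⟨P₁, f₁⟩ := h₁.exists_isFirstOrderPair hε₀ hε₁ hj₀.le hj₁ hB c₁
      obtain ⟨P₂, f₂⟩ := h₂.exists_isFirstOrderPair hε₀ hε₁ hj₀.le hj₁ hB c₂
      have h := f₁.eqOn_of_small hε₀ hε₁ hj₀.le hj₁ ha₀ ha₁ hK ha₂ f₂
        fun r hr => by linarith [hm r hr]
      exact ⟨h.1, h.2.1⟩
    · have f₁ := h₁.isFirstOrderPair hε₀ hε₁ hb
      have f₂ := h₂.isFirstOrderPair hε₀ hε₁ hb
      have h := f₁.eqOn_of_small hε₀ hε₁ hj₀.le hj₁ ha₀ ha₁ hK ha₂ f₂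
        fun r hr => by linarith [hn r hr]
      exact ⟨EqOn.of_sq_mul hε₀ h.1, EqOn.of_sq_mul hε₀ h.2.1, EqOn.of_sq_mul hε₀ h.2.2⟩
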